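/- Notation. Put $c_0=0.001$ and $g(t)=e^t-t-1$. For $y\in\mathbb R^n$ let $\|y\|_{\psi,n}=\inf\{t>0:\ \frac1{en}\sum_{i=1}^n e^{|y_i|/t}\le 1\}$, let $\|y\|_\infty=\max_i|y_i|$, and let $S^{n-1}$ be the Euclidean unit sphere. For $\mathbf d^{in},\mathbf d^{out}\in\mathbb N_0^n$ let $\mathcal M_n(\mathbf d^{in},\mathbf d^{out})$ be the set of $n\times n$ $0$-$1$ matrices whose $j$-th column has exactly $\mathbf d^{in}_j$ ones and whose $i$-th row has exactly $\mathbf d^{out}_i$ ones, for all $i,j\le n$. Theorem. There is a universal constant $C>0$ such that for every $L>0$ there is $\gamma=\gamma(L)\in(0,1]$ with the following property. Let $n\ge 1$ and $d\ge 0$ be integers with $C\ln^2 n\le d\le(\frac12+c_0)n$, let $\mathbf d^{in},\mathbf d^{out}\in\mathbb N_0^n$ satisfy $(1-c_0)d\le \mathbf d^{in}_i,\mathbf d^{out}_i\le d$ for all $i\le n$, let $0\le m\le c_0n$ be an integer, and let $Y^1,\dots,Y^m\in\{0,1\}^n$ be such that the set $$\widetilde{\mathcal M}_n=\{M\in\mathcal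 M_n(\mathbf d^{in},\mathbf d^{out}):\ \mathrm{row}_i(M)=Y^i\text{ for all }i\le m\}$$ is non-empty. Put $p_\ell=\mathbf d^{in}_\ell-|\{i\le m: Y^i_\ell=1\}|$ and assume that $\mathbf d^{in}_\ell\ge p_\ell\ge(1-2c_0)\mathbf d^{in}_\ell$ for all $\ell\le n$. Let $\mathcal P\in\mathbb R^n$ be the vector with coordinates $\mathcal P_\ell=\sum_{j=1}^n|p_\ell-p_j|$, and assume that $\|\mathcal P\|_{\psi,n}\le Ln\sqrt d$. Let $v$ be distributed as the $(m+1)$-st row of a uniformly random element of $\mathcal M_n(\mathbf d^{in},\mathbf d^{out})$ conditioned on belonging to $\widetilde{\mathcal M}_n$. Then for every $x\in S^{n-1}$, with $\eta=\langle v,x\rangle-\mathbb E\langle v,x\rangle$, $$\mathbb E\,e^{\gamma\lambda\eta}\le\exp\Big(\frac{d}{n\|x\|_\infty^2}\,g(\lambda\|x\|_\infty)\Big)\qquad\text{for all }\lambda>0.$$ -/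

import Mathlib

open scoped BigOperators

namespace RowConcentration

noncomputable section

/-- The absolute constant `c₀ = 0.001`. -/
def c₀ : ℝ := 1 / 1000

/-- The function `g(t) = e^t - t - 1`. -/
def g (t : ℝ) : ℝ := Real.exp t - t - 1

/-- The Orlicz norm
`‖x‖_{ψ,n} = inf {t > 0 : (1 / (e n)) ∑ᵢ exp (|xᵢ| / t) ≤ 1}` on `ℝⁿ`. -/
def psiNorm {n : ℕ} (x : Fin n → ℝ) : ℝ :=
  sInf {t : ℝ | 0 < t ∧ 1 / (Real.exp 1 * (n : ℝ)) * ∑ i, Real.exp (|x i| / t) ≤ 1}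

/-- The maximum norm `‖x‖_∞ = maxᵢ |xᵢ|`: the norm of the underlying function in Mathlib's
`Fin n → ℝ` is the supremum norm. -/
def supNorm {n : ℕ} (x : EuclideanSpace ℝ (Fin n)) : ℝ := ‖(WithLp.ofLp x : Fin n → ℝ)‖

/-- A `0`-`1` vector, coded by Booleans, as a vector of `ℝⁿ`. -/
def zeroOne {n : ℕ} (v : Fin n → Bool) : EuclideanSpace ℝ (Fin n) :=
  WithLp.toLp 2 fun j => if v j = true then 1 else 0

/-- Square `0`-`1` matrices, coded by Booleans (adjacency matrices of directed graphs in which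
loops are allowed and multiple edges are not); `M i` is the `i`-th row. -/
abbrev BoolMatrix (n : ℕ) : Type := Fin n → Fin n → Bool

/-- The set `𝓜ₙ(dⁱⁿ, dᵒᵘᵗ)` of `0`-`1` matrices whose `j`-th column has exactly `din j` ones and
whose `i`-th row has exactly `dout i` ones. -/
def matrices {n : ℕ} (din dout : Fin n → ℕ) : Set (BoolMatrix n) :=
  {M | (∀ j, (Finset.univ.filter fun i => M i j = true).card = din j) ∧
       (∀ i, (Finset.univ.filter fun j => M i j = true).card = dout i)}

/-- The matrices of `𝓜ₙ(dⁱⁿ, dᵒᵘᵗ)` whose first `m` rows are `Y 0, …, Y (m - 1)`. -/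
def matricesWithRows {n : ℕ} (din dout : Fin n → ℕ) {m : ℕ} (hmn : m < n)
    (Y : Fin m → Fin n → Bool) : Set (BoolMatrix n) :=
  {M | M ∈ matrices din dout ∧ ∀ i : Fin m, M (Fin.castLE hmn.le i) = Y i}

/-- The law `ℙ_Ω` of the `(m+1)`-st row (with index `m` when one counts from `0`) of a uniform
random element of `𝓜ₙ(dⁱⁿ, dᵒᵘᵗ)` conditioned on its first `m` rows being `Y`. -/
def rowLaw {n : ℕ} (din dout : Fin n → ℕ) {m : ℕ} (hmn : m < n)
    (Y : Fin m → Fin n → Bool) : MeasureTheory.Measure (Fin n → Bool) :=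
  (ProbabilityTheory.cond (ProbabilityTheory.uniformOn (matrices din dout))
    (matricesWithRows din dout hmn Y)).map fun M => M ⟨m, hmn⟩

/-- `p_ℓ = dⁱⁿ_ℓ - |{i ≤ m : Yⁱ_ℓ = 1}|`. -/
def p {n : ℕ} (din : Fin n → ℕ) {m : ℕ} (Y : Fin m → Fin n → Bool) (l : Fin n) : ℝ :=
  (din l : ℝ) - ((Finset.univ.filter fun i => Y i l = true).card : ℝ)

/-- The vector `𝒫` with coordinates `𝒫_ℓ = ∑ⱼ |p_ℓ - p_j|`. -/
def pVector {n : ℕ} (din : Fin n → ℕ) {m : ℕ} (Y : Fin m → Fin n → Bool) (l : Fin n) : ℝ :=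
  ∑ j, |p din Y l - p din Y j|

/-- The centred random variable `η(v) = ⟨v, x⟩ - 𝔼⟨·, x⟩` on the space of `0`-`1` vectors
with law `μ`. -/
def eta {n : ℕ} (μ : MeasureTheory.Measure (Fin n → Bool)) (x : EuclideanSpace ℝ (Fin n))
    (v : Fin n → Bool) : ℝ :=
  inner ℝ (zeroOne v) x - ∫ w, inner ℝ (zeroOne w) x ∂μ

end

end RowConcentration

/-!
Write `v = 1_S` for a random set `S` of columns of size `k`, and let `μ S` be the weight of `S`.

*Near exchangeability.* The law `μ` would be uniform on the `k`-sets if all `p_ℓ` were equal. In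
general, for a `(k - 1)`-set `T` and `i, j ∉ T`, the weights `μ (T ∪ {i})` and `μ (T ∪ {j})` agree
up to a relative error `12 |p_i - p_j| / d` (`abs_card_fiber_sub_le`). A switching in the columns
`i`, `j` that involves the row `v` and one lower row gives the exact formula `sum_fiber_div`: with
`Δ = p_i - p_j ≥ 0`, the ratio of the two weights is the average of `b / (b + Δ)`, where `b` is the
number of lower rows in which column `i` has a zero and column `j` a one. Hence it suffices that
`1 / (b + 1)` has average `O(1 / d)` (`sum_inv_card_differ_le`). This follows from one double
count of the switchings of two lower rows that raise `b` by one: a matrix with `b < d / 10` admits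
order `n d ^ 2` of them, whereas only `O(b d ^ 2)` lead to a given matrix.

*Concentration.* Let `f S = ∑_{i ∈ S} x_i`, let `h = f - 𝔼 f`, and let `r ^ 2 = d / n`. Up to a
constant, `n f S` is `∑_{i ∈ S, j ∉ S} (x_i - x_j)`; symmetrising `𝔼[h φ]` in `i` and `j` yields the
covariance estimate `mean_centred_mul_le`, with one term for the increments of `φ` and an error term
`O(r) 𝔼|φ - 𝔼 φ|` for the lack of exchangeability. The vector `𝒫` enters only here, through its
second moment. For `φ = h` the estimate gives `𝔼|h| = O(r)`. For `φ = exp (t h)` it gives the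
differential inequality `M' ≤ C r ^ 2 t exp (2 t K) M` for the moment generating function `M`
(`mean_centred_mul_exp_le`), where `K` is the maximum norm of `x`, once `𝔼|φ - 𝔼 φ|` is bounded
by `2 t (M' + 𝔼|h|)` for small `t` and by `2 M` for large `t`. Integrating this inequality proves
the claim for small `γ` (`mean_exp_le`).
-/

open MeasureTheory ProbabilityTheory

namespace RowConcentration

/-! ### Linear forms under nearly exchangeable laws on sets -/

section SubsetLaw

variable {ι : Type*} [Fintype ι]

/-- The expectation of `φ` under the (signed) weights `μ` on the subsets of `ι`. -/
def mean (μ φ : Finset ι → ℝ) : ℝ := ∑ S, μ S * φ S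

theorem mean_mono {μ : Finset ι → ℝ} (h0 : ∀ S, 0 ≤ μ S) {φ ψ : Finset ι → ℝ}
    (h : ∀ S, φ S ≤ ψ S) : mean μ φ ≤ mean μ ψ :=
  Finset.sum_le_sum fun S _ => mul_le_mul_of_nonneg_left (h S) (h0 S)

theorem mean_add (μ φ ψ : Finset ι → ℝ) :
    mean μ (fun S => φ S + ψ S) = mean μ φ + mean μ ψ := by
  simp [mean, mul_add, Finset.sum_add_distrib]

theorem mean_const_mul (μ φ : Finset ι → ℝ) (c : ℝ) :
    mean μ (fun S => c * φ S) = c * mean μ φ := by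
  simp only [mean, Finset.mul_sum]
  exact Finset.sum_congr rfl fun S _ => by ring

theorem sum_abs_le_sqrt_card {x : ι → ℝ} (hx : ∑ i, x i ^ 2 ≤ 1) :
    ∑ i, |x i| ≤ √(Fintype.card ι) := by
  refine Real.le_sqrt_of_sq_le ?_
  have := sq_sum_le_card_mul_sum_sq (s := Finset.univ) (f := fun i => |x i|)
  simp only [sq_abs, Finset.card_univ] at this
  nlinarith [(Nat.cast_nonneg (Fintype.card ι) : (0:ℝ) ≤ _)]

theorem sum_abs_sub_le {x : ι → ℝ} (hx : ∑ i, x i ^ 2 ≤ 1) (i : ι) (s : Finset ι) :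
    ∑ j ∈ s, |x i - x j| ≤ Fintype.card ι * |x i| + √(Fintype.card ι) := by
  calc ∑ j ∈ s, |x i - x j| ≤ ∑ j, |x i - x j| :=
        Finset.sum_le_sum_of_subset_of_nonneg (Finset.subset_univ s) fun _ _ _ => abs_nonneg _
    _ ≤ ∑ j, (|x i| + |x j|) := Finset.sum_le_sum fun j _ => abs_sub _ _
    _ = Fintype.card ι * |x i| + ∑ j, |x j| := by
        simp [Finset.sum_add_distrib]
    _ ≤ _ := by gcongr; exact sum_abs_le_sqrt_card hx

/-- The linear form `S ↦ ∑_{i ∈ S} x i`. -/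
def linForm (x : ι → ℝ) (S : Finset ι) : ℝ := ∑ i ∈ S, x i

/-- The linear form `linForm x`, centred under `μ`. -/
def centred (μ : Finset ι → ℝ) (x : ι → ℝ) (S : Finset ι) : ℝ :=
  linForm x S - mean μ (linForm x)

theorem hasDerivAt_mean_exp (μ : Finset ι → ℝ) (x : ι → ℝ) (t : ℝ) :
    HasDerivAt (fun t => mean μ (fun S => Real.exp (t * centred μ x S)))
      (mean μ (fun S => centred μ x S * Real.exp (t * centred μ x S))) t := by
  unfold mean
  refine HasDerivAt.fun_sum fun S _ => ?_
  have := (((hasDerivAt_id t).mul_const (centred μ x S)).exp).const_mul (μ S)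
  simp only [id, one_mul] at this
  beta_reduce
  rw [mul_comm (centred _ _ _)]
  exact this

variable [DecidableEq ι]

/-- The weight of `T` under the law obtained from `μ` by deleting an element in all possible ways:
`∑_{l ∉ T} μ (T ∪ {l})`. -/
def shadow (μ : Finset ι → ℝ) (T : Finset ι) : ℝ := ∑ l ∈ Tᶜ, μ (insert l T)

/-- A probability law on the `k`-element subsets of `ι` under which the weights of two sets that
differ by exchanging `j` for `i` agree up to the relative error `δ i j`. -/
structure NearlyExchangeable (μ : Finset ι → ℝ) (k : ℕ) (δ : ι → ι → ℝ) : Prop where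
  nonneg : ∀ S, 0 ≤ μ S
  sum_eq_one : ∑ S, μ S = 1
  card_eq : ∀ S, μ S ≠ 0 → S.card = k
  err_nonneg : ∀ i j, 0 ≤ δ i j
  err_symm : ∀ i j, δ i j = δ j i
  err_le_one : ∀ i j, δ i j ≤ 1
  close : ∀ T i j, i ∉ T → j ∉ T → |μ (insert i T) - μ (insert j T)| ≤ δ i j * μ (insert j T)

theorem sum_sum_mem_eq_sum_sum_insert (F : Finset ι → ι → ℝ) :
    ∑ S, ∑ i ∈ S, F S i = ∑ T : Finset ι, ∑ i ∈ Tᶜ, F (insert i T) i := by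
  rw [Finset.sum_sigma', Finset.sum_sigma']
  refine Finset.sum_bij' (fun p _ => ⟨p.1.erase p.2, p.2⟩) (fun p _ => ⟨insert p.2 p.1, p.2⟩)
    ?_ ?_ ?_ ?_ ?_
  · rintro ⟨S, i⟩ h; simp
  · rintro ⟨S, i⟩ h; simp
  · rintro ⟨S, i⟩ h
    simp only [Finset.mem_sigma, Finset.mem_univ, true_and] at h
    simp [Finset.insert_erase h]
  · rintro ⟨S, i⟩ h
    simp only [Finset.mem_sigma, Finset.mem_univ, true_and, Finset.mem_compl] at h
    simp [Finset.erase_insert h]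
  · rintro ⟨S, i⟩ h
    simp only [Finset.mem_sigma, Finset.mem_univ, true_and] at h
    simp [Finset.insert_erase h]

theorem centred_insert (x : ι → ℝ) {T : Finset ι} {i : ι} (hi : i ∉ T) :
    centred μ x (insert i T) = x i + centred μ x T := by
  simp only [centred, linForm, Finset.sum_insert hi]; ring

theorem sum_shadow_mul (μ ω : Finset ι → ℝ) :
    ∑ T, shadow μ T * ω T = mean μ fun S => ∑ l ∈ S, ω (S.erase l) := by
  have := sum_sum_mem_eq_sum_sum_insert (fun S l => μ S * ω (S.erase l))
  simp only [mean, Finset.mul_sum]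
  rw [this]
  refine Finset.sum_congr rfl fun T _ => ?_
  rw [shadow, Finset.sum_mul]
  refine Finset.sum_congr rfl fun l hl => ?_
  rw [Finset.erase_insert (Finset.mem_compl.1 hl)]

/-- Exchanging an element of `S` for one outside acts on linear forms, up to constants, as
multiplication by the dimension. -/
theorem sum_exchange (x : ι → ℝ) (S : Finset ι) :
    ∑ i ∈ S, ∑ j ∈ Sᶜ, (x i - x j)
      = Fintype.card ι * linForm x S - S.card * ∑ j, x j := by
  have h1 : ∑ j ∈ Sᶜ, x j = ∑ j, x j - linForm x S := by
    rw [linForm, ← Finset.sum_add_sum_compl S x]; ring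
  have h3 : ((Sᶜ).card : ℝ) = Fintype.card ι - S.card := by
    rw [Finset.card_compl, Nat.cast_sub (Finset.card_le_univ S)]
  simp only [Finset.sum_sub_distrib, Finset.sum_const, nsmul_eq_mul, h1, h3, ← Finset.mul_sum]
  rw [← linForm]; ring

namespace NearlyExchangeable

variable {μ : Finset ι → ℝ} {k : ℕ} {δ : ι → ι → ℝ}

theorem mean_const (H : NearlyExchangeable μ k δ) (c : ℝ) : mean μ (fun _ => c) = c := by
  simp [mean, ← Finset.sum_mul, H.sum_eq_one]

theorem mean_sub_const (H : NearlyExchangeable μ k δ) (φ : Finset ι → ℝ) (c : ℝ) :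
    mean μ (fun S => φ S - c) = mean μ φ - c := by
  have := mean_add μ φ (fun _ => -c)
  rw [H.mean_const] at this
  simpa [sub_eq_add_neg] using this

theorem mean_centred (H : NearlyExchangeable μ k δ) (x : ι → ℝ) : mean μ (centred μ x) = 0 := by
  unfold centred
  rw [H.mean_sub_const, sub_self]

theorem shadow_nonneg (H : NearlyExchangeable μ k δ) (T : Finset ι) : 0 ≤ shadow μ T :=
  Finset.sum_nonneg fun _ _ => H.nonneg _

/-- The weights `μ (T ∪ {i})`, `i ∉ T`, are comparable with each other, hence with their average. -/
theorem card_mul_le_shadow (H : NearlyExchangeable μ k δ)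
    (hk : (Fintype.card ι : ℝ) ≤ 3 * (Fintype.card ι - k)) {T : Finset ι} {i : ι} (hi : i ∉ T) :
    (Fintype.card ι : ℝ) * μ (insert i T) ≤ 6 * shadow μ T := by
  by_cases h0 : μ (insert i T) = 0
  · rw [h0, mul_zero]; exact mul_nonneg (by norm_num) (H.shadow_nonneg T)
  have hc := H.card_eq _ h0
  rw [Finset.card_insert_of_notMem hi] at hc
  have h1 : ((Tᶜ).card : ℝ) * μ (insert i T) ≤ 2 * shadow μ T := by
    rw [shadow, Finset.mul_sum, ← nsmul_eq_mul]
    refine Finset.card_nsmul_le_sum _ _ _ fun j hj => ?_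
    have h2 := (le_abs_self _).trans (H.close T i j hi (Finset.mem_compl.1 hj))
    nlinarith [H.nonneg (insert j T), H.err_le_one i j]
  have h3 : ((Tᶜ).card : ℝ) = Fintype.card ι - T.card := by
    rw [Finset.card_compl, Nat.cast_sub (Finset.card_le_univ T)]
  rw [h3] at h1
  have h4 : (k : ℝ) = T.card + 1 := by exact_mod_cast hc.symm
  nlinarith [H.nonneg (insert i T)]

theorem sum_shadow_mul_le (H : NearlyExchangeable μ k δ) {ω ψ : Finset ι → ℝ}
    (h : ∀ S, ∀ l ∈ S, ω (S.erase l) ≤ ψ S) :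
    ∑ T, shadow μ T * ω T ≤ k * mean μ ψ := by
  rw [sum_shadow_mul, ← mean_const_mul]
  refine Finset.sum_le_sum fun S _ => ?_
  by_cases h0 : μ S = 0
  · simp [h0]
  refine mul_le_mul_of_nonneg_left ?_ (H.nonneg S)
  beta_reduce
  rw [← H.card_eq S h0, ← nsmul_eq_mul]
  exact Finset.sum_le_card_nsmul _ _ _ (h S)

/-- The covariance with a linear form as a sum over exchanges. -/
theorem card_mul_mean_centred_mul (H : NearlyExchangeable μ k δ) (x : ι → ℝ) {φ : Finset ι → ℝ}
    (hφ : mean μ φ = 0) :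
    Fintype.card ι * mean μ (fun S => centred μ x S * φ S)
      = ∑ T : Finset ι, ∑ i ∈ Tᶜ, ∑ j ∈ Tᶜ, (x i - x j) * (μ (insert i T) * φ (insert i T)) := by
  have h1 : Fintype.card ι * mean μ (fun S => centred μ x S * φ S)
      = ∑ S, ∑ i ∈ S, μ S * φ S * ∑ j ∈ Sᶜ, (x i - x j) := by
    have h2 : ∀ S, ∑ i ∈ S, μ S * φ S * ∑ j ∈ Sᶜ, (x i - x j)
        = Fintype.card ι * (μ S * (centred μ x S * φ S))
          + (Fintype.card ι * mean μ (linForm x) - k * ∑ j, x j) * (μ S * φ S) := by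
      intro S
      rw [← Finset.mul_sum, sum_exchange]
      by_cases h0 : μ S = 0
      · simp [h0]
      rw [H.card_eq S h0, centred]; ring
    simp only [h2]
    rw [Finset.sum_add_distrib, ← Finset.mul_sum, ← Finset.mul_sum]
    change _ = _ + _ * mean μ φ
    rw [hφ, mean]; ring
  rw [h1, sum_sum_mem_eq_sum_sum_insert (fun S i => μ S * φ S * ∑ j ∈ Sᶜ, (x i - x j))]
  refine Finset.sum_congr rfl fun T _ => Finset.sum_congr rfl fun i hi => ?_
  rw [Finset.compl_insert, Finset.mul_sum, ← Finset.add_sum_erase _ _ hi]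
  simp only [sub_self, zero_mul, zero_add]
  exact Finset.sum_congr rfl fun j _ => by ring

/-! ### The covariance estimate -/

theorem sum_abs_sub_mul_err_le (H : NearlyExchangeable μ k δ) {x : ι → ℝ}
    (hx : ∑ i, x i ^ 2 ≤ 1) {R : ℝ} (hR : 0 ≤ R) (hδ : ∑ i, (∑ j, δ i j) ^ 2 ≤ R ^ 2) :
    ∑ i, ∑ j, |x i - x j| * δ i j ≤ 2 * R := by
  have h1 : ∑ i, |x i| * ∑ j, δ i j ≤ R := by
    have := Finset.sum_mul_sq_le_sq_mul_sq Finset.univ (fun i => |x i|) (fun i => ∑ j, δ i j)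
    simp only [sq_abs] at this
    refine abs_le_of_sq_le_sq' ?_ hR |>.2
    have h0 : 0 ≤ ∑ i, (∑ j, δ i j) ^ 2 := Finset.sum_nonneg fun _ _ => sq_nonneg _
    nlinarith
  calc ∑ i, ∑ j, |x i - x j| * δ i j ≤ ∑ i, ∑ j, (|x i| * δ i j + |x j| * δ j i) := by
        refine Finset.sum_le_sum fun i _ => Finset.sum_le_sum fun j _ => ?_
        rw [H.err_symm j i, ← add_mul]
        exact mul_le_mul_of_nonneg_right (abs_sub _ _) (H.err_nonneg i j)
    _ = 2 * ∑ i, |x i| * ∑ j, δ i j := by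
        simp only [Finset.sum_add_distrib, Finset.mul_sum]
        rw [Finset.sum_comm (f := fun i j => |x j| * δ j i)]
        simp only [← Finset.mul_sum]; ring
    _ ≤ _ := by linarith

/-- The contribution of the asymmetry of the weights: exchanging `i` and `j` in the double sum
turns `μ (T ∪ {i})` into half the difference `μ (T ∪ {i}) - μ (T ∪ {j})`. -/
theorem abs_sum_exchange_le (H : NearlyExchangeable μ k δ)
    (hk : (Fintype.card ι : ℝ) ≤ 3 * (Fintype.card ι - k)) (x : ι → ℝ) (T : Finset ι) :
    Fintype.card ι * |∑ i ∈ Tᶜ, ∑ j ∈ Tᶜ, (x i - x j) * μ (insert i T)|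
      ≤ 3 * shadow μ T * ∑ i, ∑ j, |x i - x j| * δ i j := by
  have hc : (0 : ℝ) ≤ Fintype.card ι := Nat.cast_nonneg _
  have h1 : 2 * ∑ i ∈ Tᶜ, ∑ j ∈ Tᶜ, (x i - x j) * μ (insert i T)
      = ∑ i ∈ Tᶜ, ∑ j ∈ Tᶜ, (x i - x j) * (μ (insert i T) - μ (insert j T)) := by
    have h2 := Finset.sum_comm (s := Tᶜ) (t := Tᶜ) (f := fun i j => (x i - x j) * μ (insert i T))
    calc _ = ∑ i ∈ Tᶜ, ∑ j ∈ Tᶜ, (x i - x j) * μ (insert i T)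
          + ∑ i ∈ Tᶜ, ∑ j ∈ Tᶜ, (x j - x i) * μ (insert j T) := by rw [← h2]; ring
      _ = _ := by
        simp only [← Finset.sum_add_distrib]
        exact Finset.sum_congr rfl fun i _ => Finset.sum_congr rfl fun j _ => by ring
  have h3 : Fintype.card ι * |∑ i ∈ Tᶜ, ∑ j ∈ Tᶜ, (x i - x j) * (μ (insert i T) - μ (insert j T))|
      ≤ ∑ i ∈ Tᶜ, ∑ j ∈ Tᶜ, |x i - x j| * δ i j * (6 * shadow μ T) := by
    calc _ ≤ Fintype.card ι * ∑ i ∈ Tᶜ, ∑ j ∈ Tᶜ,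
            |(x i - x j) * (μ (insert i T) - μ (insert j T))| := by
          gcongr
          exact (Finset.abs_sum_le_sum_abs _ _).trans
            (Finset.sum_le_sum fun i _ => Finset.abs_sum_le_sum_abs _ _)
      _ ≤ _ := by
          simp only [Finset.mul_sum]
          refine Finset.sum_le_sum fun i hi => Finset.sum_le_sum fun j hj => ?_
          rw [Finset.mem_compl] at hi hj
          rw [abs_mul]
          have e1 := mul_le_mul_of_nonneg_left (H.close T i j hi hj) hc
          have e2 := mul_le_mul_of_nonneg_left (H.card_mul_le_shadow hk hj) (H.err_nonneg i j)
          calc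
            _ = |x i - x j| * (Fintype.card ι * |μ (insert i T) - μ (insert j T)|) := by ring
            _ ≤ |x i - x j| * (δ i j * (6 * shadow μ T)) :=
              mul_le_mul_of_nonneg_left (by linarith) (abs_nonneg _)
            _ = _ := by ring
  have h4 : ∑ i ∈ Tᶜ, ∑ j ∈ Tᶜ, |x i - x j| * δ i j * (6 * shadow μ T)
      ≤ ∑ i, ∑ j, |x i - x j| * δ i j * (6 * shadow μ T) := by
    have hp : ∀ i j, 0 ≤ |x i - x j| * δ i j * (6 * shadow μ T) := fun i j =>
      mul_nonneg (mul_nonneg (abs_nonneg _) (H.err_nonneg i j))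
        (mul_nonneg (by norm_num) (H.shadow_nonneg T))
    calc _ ≤ ∑ i ∈ Tᶜ, ∑ j, |x i - x j| * δ i j * (6 * shadow μ T) :=
          Finset.sum_le_sum fun i _ => Finset.sum_le_sum_of_subset_of_nonneg
            (Finset.subset_univ _) fun j _ _ => hp i j
      _ ≤ _ := Finset.sum_le_sum_of_subset_of_nonneg (Finset.subset_univ _)
            fun i _ _ => Finset.sum_nonneg fun j _ => hp i j
  rw [← h1, abs_mul, abs_two] at h3
  have h5 := h3.trans h4
  have h6 : ∑ i, ∑ j, |x i - x j| * δ i j * (6 * shadow μ T)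
      = (∑ i, ∑ j, |x i - x j| * δ i j) * (6 * shadow μ T) := by
    simp only [Finset.sum_mul]
  rw [h6] at h5
  linarith

/-- The insertion increments of `φ`, weighted by `μ`. -/
theorem sum_abs_mul_insert_le (H : NearlyExchangeable μ k δ)
    (hk : (Fintype.card ι : ℝ) ≤ 3 * (Fintype.card ι - k)) {x : ι → ℝ} {φ ω : Finset ι → ℝ}
    (hω : ∀ T, ∀ i ∉ T, |φ (insert i T) - φ T| ≤ |x i| * ω T) (hω0 : ∀ T, 0 ≤ ω T)
    {c : ι → ℝ} (hc : ∀ i, 0 ≤ c i) (T : Finset ι) :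
    Fintype.card ι * ∑ i ∈ Tᶜ, μ (insert i T) * |φ (insert i T) - φ T| * c i
      ≤ 6 * (shadow μ T * ω T) * ∑ i, |x i| * c i := by
  calc _ = ∑ i ∈ Tᶜ, (Fintype.card ι * μ (insert i T)) * |φ (insert i T) - φ T| * c i := by
        rw [Finset.mul_sum]; exact Finset.sum_congr rfl fun i _ => by ring
    _ ≤ ∑ i ∈ Tᶜ, (6 * shadow μ T) * (|x i| * ω T) * c i := by
        refine Finset.sum_le_sum fun i hi => ?_
        rw [Finset.mem_compl] at hi
        refine mul_le_mul_of_nonneg_right ?_ (hc i)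
        exact mul_le_mul (H.card_mul_le_shadow hk hi) (hω T i hi) (abs_nonneg _)
          (mul_nonneg (by norm_num) (H.shadow_nonneg T))
    _ ≤ ∑ i, (6 * shadow μ T) * (|x i| * ω T) * c i :=
        Finset.sum_le_sum_of_subset_of_nonneg (Finset.subset_univ _) fun i _ _ =>
          mul_nonneg (mul_nonneg (mul_nonneg (by norm_num) (H.shadow_nonneg T))
            (mul_nonneg (abs_nonneg _) (hω0 T))) (hc i)
    _ = _ := by
        rw [Finset.mul_sum]; exact Finset.sum_congr rfl fun i _ => by ring

/-- The covariance estimate: the covariance of a linear form with `φ` is controlled by the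
increments of `φ` and, to the extent that the law fails to be exchangeable, by the mean deviation
of `φ`. -/
theorem mean_centred_mul_le [Nonempty ι] (H : NearlyExchangeable μ k δ)
    (hk : (Fintype.card ι : ℝ) ≤ 3 * (Fintype.card ι - k)) {x : ι → ℝ}
    (hx : ∑ i, x i ^ 2 ≤ 1) {r Λ : ℝ} (hr : 0 < r) (hΛ : 0 ≤ Λ)
    (hkr : (k : ℝ) ≤ Fintype.card ι * r ^ 2) (hr1 : 1 ≤ Fintype.card ι * r ^ 2)
    (hδ : ∑ i, (∑ j, δ i j) ^ 2 ≤ (Λ * Fintype.card ι / r) ^ 2) {φ ω : Finset ι → ℝ}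
    (hω : ∀ T, ∀ i ∉ T, |φ (insert i T) - φ T| ≤ |x i| * ω T) (hω0 : ∀ T, 0 ≤ ω T) :
    mean μ (fun S => centred μ x S * φ S)
      ≤ (12 + 36 * Λ) * ((∑ T, shadow μ T * ω T) / Fintype.card ι)
        + 6 * Λ * r * mean μ (fun S => |φ S - mean μ φ|) := by
  set n : ℝ := (Fintype.card ι : ℝ) with hn
  have hnpos : 0 < n := by rw [hn]; exact_mod_cast Fintype.card_pos
  set ψ : Finset ι → ℝ := fun S => φ S - mean μ φ with hψ
  set Ω := ∑ T, shadow μ T * ω T with hΩ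
  have hΩ0 : 0 ≤ Ω := Finset.sum_nonneg fun T _ => mul_nonneg (H.shadow_nonneg T) (hω0 T)
  have hsq : √n * √n = n := Real.mul_self_sqrt hnpos.le
  have hψ0 : mean μ ψ = 0 := by rw [hψ, H.mean_sub_const, sub_self]
  have hd : ∀ T i, ψ (insert i T) - ψ T = φ (insert i T) - φ T := fun T i => by simp [hψ]
  have hcov : mean μ (fun S => centred μ x S * φ S) = mean μ (fun S => centred μ x S * ψ S) := by
    have h1 : (fun S => centred μ x S * φ S)
        = fun S => centred μ x S * ψ S + mean μ φ * centred μ x S := by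
      funext S; simp only [hψ]; ring
    rw [h1, mean_add, mean_const_mul, H.mean_centred]; ring
  -- Splitting `ψ (insert i T) = (ψ (insert i T) - ψ T) + ψ T` separates the two effects.
  have hsplit : n * mean μ (fun S => centred μ x S * ψ S)
      = ∑ T : Finset ι, ∑ i ∈ Tᶜ, μ (insert i T) * (φ (insert i T) - φ T) * ∑ j ∈ Tᶜ, (x i - x j)
        + ∑ T : Finset ι, ψ T * ∑ i ∈ Tᶜ, ∑ j ∈ Tᶜ, (x i - x j) * μ (insert i T) := by
    rw [hn, H.card_mul_mean_centred_mul x hψ0, ← Finset.sum_add_distrib]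
    refine Finset.sum_congr rfl fun T _ => ?_
    simp only [Finset.mul_sum, ← Finset.sum_add_distrib, ← hd]
    exact Finset.sum_congr rfl fun i _ => Finset.sum_congr rfl fun j _ => by ring
  have hxs : ∑ i, |x i| * (n * |x i| + √n) ≤ 2 * n := by
    have h1 : ∑ i, |x i| * (n * |x i| + √n) = n * ∑ i, x i ^ 2 + √n * ∑ i, |x i| := by
      rw [Finset.mul_sum, Finset.mul_sum, ← Finset.sum_add_distrib]
      exact Finset.sum_congr rfl fun i _ => by rw [← sq_abs]; ring
    rw [h1]
    nlinarith [sum_abs_le_sqrt_card hx, Real.sqrt_nonneg n]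
  have hT1 : n * ∑ T : Finset ι, ∑ i ∈ Tᶜ,
      μ (insert i T) * (φ (insert i T) - φ T) * ∑ j ∈ Tᶜ, (x i - x j) ≤ 12 * n * Ω := by
    calc _ ≤ ∑ T : Finset ι, n * ∑ i ∈ Tᶜ,
          μ (insert i T) * |φ (insert i T) - φ T| * (n * |x i| + √n) := by
          rw [Finset.mul_sum]
          refine Finset.sum_le_sum fun T _ => ?_
          refine mul_le_mul_of_nonneg_left (Finset.sum_le_sum fun i _ => ?_) hnpos.le
          refine (le_abs_self _).trans ?_
          rw [abs_mul, abs_mul, abs_of_nonneg (H.nonneg _)]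
          have := H.nonneg (insert i T)
          gcongr
          exact (Finset.abs_sum_le_sum_abs _ _).trans (sum_abs_sub_le hx i _)
      _ ≤ ∑ T : Finset ι, 6 * (shadow μ T * ω T) * (2 * n) := by
          refine Finset.sum_le_sum fun T _ => ?_
          refine (H.sum_abs_mul_insert_le hk hω hω0
            (c := fun i => n * |x i| + √n) (fun i => by positivity) T).trans ?_
          have := mul_nonneg (H.shadow_nonneg T) (hω0 T)
          gcongr
      _ = _ := by rw [← Finset.sum_mul, ← Finset.mul_sum]; ring
  have hΔ : ∑ T : Finset ι, ∑ i ∈ Tᶜ, μ (insert i T) * |φ (insert i T) - φ T| ≤ 6 * Ω / √n := by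
    rw [le_div_iff₀ (Real.sqrt_pos.2 hnpos)]
    have h1 : n * ∑ T : Finset ι, ∑ i ∈ Tᶜ, μ (insert i T) * |φ (insert i T) - φ T|
        ≤ 6 * Ω * √n := by
      rw [Finset.mul_sum, hΩ, Finset.mul_sum, Finset.sum_mul]
      refine Finset.sum_le_sum fun T _ => ?_
      have h2 := H.sum_abs_mul_insert_le hk hω hω0 (c := fun _ => 1) (fun i => zero_le_one) T
      simp only [mul_one] at h2
      refine h2.trans ?_
      have := mul_nonneg (H.shadow_nonneg T) (hω0 T)
      gcongr
      exact sum_abs_le_sqrt_card hx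
    have h3 := Real.sqrt_pos.2 hnpos
    refine le_of_mul_le_mul_right ?_ h3
    calc _ = n * _ := by rw [mul_assoc, hsq, mul_comm]
      _ ≤ _ := h1
  have hQ : ∑ T, shadow μ T * |ψ T| ≤ n * r ^ 2 * mean μ (fun S => |ψ S|) + 6 * Ω / √n := by
    have h1 : ∑ T, shadow μ T * |ψ T| ≤ ∑ T : Finset ι, ∑ i ∈ Tᶜ,
        (μ (insert i T) * |ψ (insert i T)| + μ (insert i T) * |φ (insert i T) - φ T|) := by
      refine Finset.sum_le_sum fun T _ => ?_
      rw [shadow, Finset.sum_mul]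
      refine Finset.sum_le_sum fun i _ => ?_
      rw [← mul_add]
      refine mul_le_mul_of_nonneg_left ?_ (H.nonneg _)
      have := abs_sub_abs_le_abs_sub (ψ T) (ψ (insert i T))
      rw [abs_sub_comm (ψ T), hd] at this
      linarith
    have h2 : ∑ T : Finset ι, ∑ i ∈ Tᶜ, μ (insert i T) * |ψ (insert i T)|
        ≤ n * r ^ 2 * mean μ (fun S => |ψ S|) := by
      rw [← sum_sum_mem_eq_sum_sum_insert (fun S _ => μ S * |ψ S|)]
      simp only [Finset.sum_const, nsmul_eq_mul]
      rw [mean, Finset.mul_sum]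
      refine Finset.sum_le_sum fun S _ => ?_
      by_cases h0 : μ S = 0
      · simp [h0]
      rw [H.card_eq S h0]
      exact mul_le_mul_of_nonneg_right hkr (mul_nonneg (H.nonneg S) (abs_nonneg _))
    simp only [Finset.sum_add_distrib] at h1
    linarith
  have hT2 : n * ∑ T : Finset ι, ψ T * ∑ i ∈ Tᶜ, ∑ j ∈ Tᶜ, (x i - x j) * μ (insert i T)
      ≤ 6 * (Λ * n / r) * ∑ T, shadow μ T * |ψ T| := by
    have hR := H.sum_abs_sub_mul_err_le hx (by positivity) hδ
    rw [Finset.mul_sum, Finset.mul_sum]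
    refine Finset.sum_le_sum fun T _ => ?_
    have h1 := H.abs_sum_exchange_le hk x T
    rw [← hn] at h1
    set A := ∑ i ∈ Tᶜ, ∑ j ∈ Tᶜ, (x i - x j) * μ (insert i T)
    have h2 : ψ T * A ≤ |ψ T| * |A| := (le_abs_self _).trans (abs_mul _ _).le
    have h3 : 3 * shadow μ T * ∑ i, ∑ j, |x i - x j| * δ i j
        ≤ 3 * shadow μ T * (2 * (Λ * n / r)) :=
      mul_le_mul_of_nonneg_left hR (mul_nonneg (by norm_num) (H.shadow_nonneg T))
    calc n * (ψ T * A) ≤ n * (|ψ T| * |A|) := by gcongr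
      _ = |ψ T| * (n * |A|) := by ring
      _ ≤ |ψ T| * (3 * shadow μ T * (2 * (Λ * n / r))) := 
          mul_le_mul_of_nonneg_left (h1.trans h3) (abs_nonneg _)
      _ = _ := by ring
  have hrn : 1 ≤ r * √n := by
    rw [← abs_of_pos (mul_pos hr (Real.sqrt_pos.2 hnpos)), ← one_le_sq_iff_one_le_abs]
    rw [mul_pow, Real.sq_sqrt hnpos.le]; linarith
  have hlast : Λ * n / r * (6 * Ω / √n) ≤ n * (6 * Λ * Ω) := by
    have hs := Real.sqrt_pos.2 hnpos
    rw [div_mul_div_comm, div_le_iff₀ (by positivity)]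
    have : 0 ≤ Λ * n * (6 * Ω) := by positivity
    nlinarith
  rw [hcov]
  have hfin : n * (n * mean μ (fun S => centred μ x S * ψ S))
      ≤ n * (n * ((12 + 36 * Λ) * (Ω / n) + 6 * Λ * r * mean μ (fun S => |ψ S|))) := by
    rw [hsplit, mul_add]
    have h5 : 6 * (Λ * n / r) * ∑ T, shadow μ T * |ψ T|
        ≤ 6 * (Λ * n / r) * (n * r ^ 2 * mean μ (fun S => |ψ S|) + 6 * Ω / √n) := by gcongr
    have h6 : Λ * n / r * (n * r ^ 2 * mean μ (fun S => |ψ S|))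
        = n * (n * (Λ * r * mean μ (fun S => |ψ S|))) := by field_simp
    have h7 : n * (n * ((12 + 36 * Λ) * (Ω / n) + 6 * Λ * r * mean μ (fun S => |ψ S|)))
        = n * ((12 + 36 * Λ) * Ω) + 6 * (n * (n * (Λ * r * mean μ (fun S => |ψ S|)))) := by
      field_simp
    rw [h7]
    nlinarith
  exact le_of_mul_le_mul_left (le_of_mul_le_mul_left hfin hnpos) hnpos

end NearlyExchangeable

/-! ### The moment generating function -/

theorem abs_exp_sub_one_le (u : ℝ) : |Real.exp u - 1| ≤ |u| * Real.exp |u| := by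
  have h1 := Real.add_one_le_exp u
  have h2 := Real.add_one_le_exp (-u)
  have h3 := Real.exp_pos u
  have h4 : Real.exp u * Real.exp (-u) = 1 := by rw [← Real.exp_add]; simp
  rcases le_total 0 u with h | h
  · rw [abs_of_nonneg h, abs_of_nonneg (by linarith)]
    nlinarith
  · rw [abs_of_nonpos h, abs_of_nonpos (by linarith [Real.exp_le_one_iff.2 h])]
    nlinarith

theorem mul_exp_half_le (u : ℝ) (hu : 0 ≤ u) : u * Real.exp (u / 2) ≤ Real.exp u - 1 := by
  have h1 : u / 2 ≤ Real.sinh (u / 2) := Real.self_le_sinh_iff.2 (by linarith)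
  rw [Real.sinh_eq] at h1
  have h2 : Real.exp (u / 2) * Real.exp (-(u / 2)) = 1 := by rw [← Real.exp_add]; simp
  have h3 : Real.exp u = Real.exp (u / 2) * Real.exp (u / 2) := by rw [← Real.exp_add]; ring_nf
  rw [h3]
  nlinarith [Real.exp_pos (u / 2)]

/-- The constant in the bound for the logarithmic derivative of the moment generating function:
twice that of the covariance estimate, plus the contributions of the error term for small `t`
and for large `t`. -/
def mgfConst (Λ : ℝ) : ℝ := 2 * (12 + 36 * Λ) + 24 * Λ * (12 + 42 * Λ) + 288 * Λ ^ 2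

namespace NearlyExchangeable
variable {μ : Finset ι → ℝ} {k : ℕ} {δ : ι → ι → ℝ}

theorem sq_mean_abs_le (H : NearlyExchangeable μ k δ) (φ : Finset ι → ℝ) :
    mean μ (fun S => |φ S|) ^ 2 ≤ mean μ (fun S => φ S * φ S) := by
  have := Finset.sum_sq_le_sum_mul_sum_of_sq_le_mul Finset.univ (r := fun S => μ S * |φ S|)
    (f := μ) (g := fun S => μ S * (φ S * φ S)) (fun S _ => H.nonneg S)
    (fun S _ => mul_nonneg (H.nonneg S) (mul_self_nonneg _))
    (fun S _ => by rw [mul_pow, sq_abs]; exact le_of_eq (by ring))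
  rwa [H.sum_eq_one, one_mul] at this

/-- The covariance estimate applied to the linear form itself. -/
theorem mean_abs_centred_le [Nonempty ι] (H : NearlyExchangeable μ k δ)
    (hk : (Fintype.card ι : ℝ) ≤ 3 * (Fintype.card ι - k)) {x : ι → ℝ}
    (hx : ∑ i, x i ^ 2 ≤ 1) {r Λ : ℝ} (hr : 0 < r) (hΛ : 0 ≤ Λ)
    (hkr : (k : ℝ) ≤ Fintype.card ι * r ^ 2) (hr1 : 1 ≤ Fintype.card ι * r ^ 2)
    (hδ : ∑ i, (∑ j, δ i j) ^ 2 ≤ (Λ * Fintype.card ι / r) ^ 2) :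
    mean μ (fun S => |centred μ x S|) ≤ (12 + 42 * Λ) * r := by
  have hn : (0 : ℝ) < Fintype.card ι := by exact_mod_cast Fintype.card_pos
  have h1 := H.mean_centred_mul_le hk hx hr hΛ hkr hr1 hδ (φ := centred μ x) (ω := fun _ => 1)
    (fun T i hi => by rw [centred_insert x hi]; simp) (fun _ => zero_le_one)
  have h2 : (∑ T, shadow μ T * 1) / (Fintype.card ι : ℝ) ≤ r ^ 2 := by
    rw [div_le_iff₀ hn]
    have := H.sum_shadow_mul_le (ω := fun _ => 1) (ψ := fun _ => 1) (fun _ _ _ => le_rfl)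
    rw [H.mean_const] at this
    linarith
  have h3 := H.sq_mean_abs_le (centred μ x)
  simp only [H.mean_centred, sub_zero] at h1
  set e := mean μ (fun S => |centred μ x S|)
  have h4 : (12 + 36 * Λ) * ((∑ T, shadow μ T * 1) / (Fintype.card ι : ℝ))
      ≤ (12 + 36 * Λ) * r ^ 2 := by gcongr
  by_contra! hlt
  have h5 : r < e := by nlinarith
  have h6 : e * e ≤ (12 + 42 * Λ) * r * e := by nlinarith [mul_nonneg hΛ hr.le]
  nlinarith

theorem one_le_mean_exp (H : NearlyExchangeable μ k δ) (x : ι → ℝ) (t : ℝ) :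
    1 ≤ mean μ (fun S => Real.exp (t * centred μ x S)) := by
  have h1 : mean μ (fun S => t * centred μ x S + 1)
      ≤ mean μ (fun S => Real.exp (t * centred μ x S)) :=
    mean_mono H.nonneg fun S => Real.add_one_le_exp _
  rw [mean_add, mean_const_mul, H.mean_centred, H.mean_const] at h1
  linarith

/-- The mean deviation of `exp (t h)`, for a centred `h`. As the mean of `exp (t h)` is at least
`1`, only the excess of `exp (t h)` over `1`, hence only the positive part of `h`, matters. -/
theorem mean_abs_exp_sub_le (H : NearlyExchangeable μ k δ) (x : ι → ℝ) {t : ℝ} (ht : 0 ≤ t) :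
    mean μ (fun S => |Real.exp (t * centred μ x S)
        - mean μ (fun S => Real.exp (t * centred μ x S))|)
      ≤ 2 * t * (mean μ (fun S => centred μ x S * Real.exp (t * centred μ x S))
          + mean μ (fun S => |centred μ x S|)) := by
  set m := mean μ (fun S => Real.exp (t * centred μ x S)) with hm
  have hm1 : 1 ≤ m := H.one_le_mean_exp x t
  have h1 : mean μ (fun S => |Real.exp (t * centred μ x S) - m|)
      ≤ mean μ (fun S => 2 * t * (centred μ x S * Real.exp (t * centred μ x S) + |centred μ x S|)
          + (m - Real.exp (t * centred μ x S))) := by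
    refine mean_mono H.nonneg fun S => ?_
    set h := centred μ x S
    have e1 := Real.add_one_le_exp (-(t * h))
    have e2 : Real.exp (t * h) * Real.exp (-(t * h)) = 1 := by rw [← Real.exp_add]; simp
    have e3 := Real.exp_pos (t * h)
    have e4 : 0 ≤ t * (h * Real.exp (t * h) + |h|) := by
      refine mul_nonneg ht ?_
      rcases le_total 0 h with hh | hh
      · have := abs_nonneg h; positivity
      · rw [abs_of_nonpos hh]
        have : Real.exp (t * h) ≤ 1 := Real.exp_le_one_iff.2 (mul_nonpos_of_nonneg_of_nonpos ht hh)
        nlinarith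
    rcases le_total (Real.exp (t * h)) m with hc | hc
    · rw [abs_of_nonpos (by linarith)]; linarith
    · rw [abs_of_nonneg (by linarith)]
      have e5 : Real.exp (t * h) - 1 ≤ t * h * Real.exp (t * h) := by nlinarith
      have e6 : 0 ≤ t * |h| := mul_nonneg ht (abs_nonneg _)
      nlinarith
  have h2 : mean μ (fun S => m - Real.exp (t * centred μ x S)) = 0 := by
    have : (fun S => m - Real.exp (t * centred μ x S))
        = fun S => (-1) * Real.exp (t * centred μ x S) + m := by funext S; ring
    rw [this, mean_add, mean_const_mul, H.mean_const, ← hm]; ring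
  rw [mean_add, mean_const_mul, mean_add, h2, add_zero] at h1
  exact h1

/-- The differential inequality for the moment generating function. -/
theorem mean_centred_mul_exp_le [Nonempty ι] (H : NearlyExchangeable μ k δ)
    (hk : (Fintype.card ι : ℝ) ≤ 3 * (Fintype.card ι - k)) {x : ι → ℝ}
    (hx : ∑ i, x i ^ 2 ≤ 1) {K : ℝ} (hK : ∀ i, |x i| ≤ K) {r Λ : ℝ} (hr : 0 < r) (hΛ : 0 ≤ Λ)
    (hkr : (k : ℝ) ≤ Fintype.card ι * r ^ 2) (hr1 : 1 ≤ Fintype.card ι * r ^ 2)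
    (hδ : ∑ i, (∑ j, δ i j) ^ 2 ≤ (Λ * Fintype.card ι / r) ^ 2) {t : ℝ} (ht : 0 ≤ t) :
    mean μ (fun S => centred μ x S * Real.exp (t * centred μ x S))
      ≤ mgfConst Λ * (r ^ 2 * t * Real.exp (2 * t * K))
        * mean μ (fun S => Real.exp (t * centred μ x S)) := by
  have hn : (0 : ℝ) < Fintype.card ι := by exact_mod_cast Fintype.card_pos
  have h1 := H.mean_centred_mul_le hk hx hr hΛ hkr hr1 hδ
    (φ := fun S => Real.exp (t * centred μ x S))
    (ω := fun T => t * Real.exp (t * K) * Real.exp (t * centred μ x T))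
    (fun T i hi => by
      rw [centred_insert x hi, mul_add, Real.exp_add]
      have e1 : Real.exp (t * x i) * Real.exp (t * centred μ x T) - Real.exp (t * centred μ x T)
          = (Real.exp (t * x i) - 1) * Real.exp (t * centred μ x T) := by ring
      rw [e1, abs_mul, abs_of_pos (Real.exp_pos (t * centred μ x T)), ← mul_assoc]
      refine mul_le_mul_of_nonneg_right ?_ (Real.exp_pos _).le
      refine (abs_exp_sub_one_le _).trans ?_
      rw [abs_mul, abs_of_nonneg ht]
      have e2 : Real.exp (t * |x i|) ≤ Real.exp (t * K) :=
        Real.exp_le_exp.2 (mul_le_mul_of_nonneg_left (hK i) ht)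
      calc t * |x i| * Real.exp (t * |x i|) ≤ t * |x i| * Real.exp (t * K) := by gcongr
        _ = _ := by ring)
    (fun T => by positivity)
  set m := mean μ (fun S => Real.exp (t * centred μ x S)) with hm
  set y := mean μ (fun S => centred μ x S * Real.exp (t * centred μ x S)) with hy
  have hm1 : 1 ≤ m := H.one_le_mean_exp x t
  set q := r ^ 2 * t * Real.exp (2 * t * K) with hq
  have hK0 : 0 ≤ K := (abs_nonneg _).trans (hK (Classical.arbitrary ι))
  have hq0 : 0 ≤ q := by positivity
  have hqt : r ^ 2 * t ≤ q := by
    have : 1 ≤ Real.exp (2 * t * K) := Real.one_le_exp (by positivity)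
    have h0 : 0 ≤ r ^ 2 * t := by positivity
    nlinarith
  have h2 : (∑ T, shadow μ T * (t * Real.exp (t * K) * Real.exp (t * centred μ x T)))
      / (Fintype.card ι : ℝ) ≤ q * m := by
    rw [div_le_iff₀ hn]
    have := H.sum_shadow_mul_le
      (ω := fun T => t * Real.exp (t * K) * Real.exp (t * centred μ x T))
      (ψ := fun S => t * Real.exp (2 * t * K) * Real.exp (t * centred μ x S)) (fun S l hl => by
        have e1 := centred_insert (μ := μ) x (Finset.notMem_erase l S)
        rw [Finset.insert_erase hl] at e1
        have e2 : t * K + t * centred μ x (S.erase l) ≤ 2 * t * K + t * centred μ x S := by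
          have := mul_le_mul_of_nonneg_left ((neg_le_abs _).trans (hK l)) ht
          rw [e1]; linarith
        have e3 := Real.exp_le_exp.2 e2
        rw [Real.exp_add, Real.exp_add] at e3
        rw [mul_assoc, mul_assoc]
        gcongr)
    rw [mean_const_mul, ← hm] at this
    calc _ ≤ _ := this
      _ ≤ (Fintype.card ι * r ^ 2) * (t * Real.exp (2 * t * K) * m) := by gcongr
      _ = _ := by rw [hq]; ring
  have h3 : (12 + 36 * Λ) * ((∑ T, shadow μ T * (t * Real.exp (t * K)
      * Real.exp (t * centred μ x T))) / (Fintype.card ι : ℝ)) ≤ (12 + 36 * Λ) * (q * m) := by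
    gcongr
  have hqm : q ≤ q * m := le_mul_of_one_le_right hq0 hm1
  have hΛq : 0 ≤ Λ * (q * m) := by positivity
  have hΛ2q : 0 ≤ Λ ^ 2 * (q * m) := by positivity
  have hqm0 : 0 ≤ q * m := by positivity
  rw [show mgfConst Λ * q * m = 2 * (12 + 36 * Λ) * (q * m) + 24 * (12 + 42 * Λ) * (Λ * (q * m))
    + 288 * (Λ ^ 2 * (q * m)) by unfold mgfConst; ring]
  -- For small `t` the mean deviation of `exp (t h)` is linear in `t` and absorbs into the left
  -- side; for large `t` the trivial bound by twice the mean is good enough.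
  rcases le_total (24 * Λ * r * t) 1 with hs | hs
  · rcases le_total y 0 with hy0 | hy0
    · exact hy0.trans (by nlinarith [mul_nonneg hΛ hΛq])
    have h4 := H.mean_abs_exp_sub_le x ht
    rw [← hm, ← hy] at h4
    have h5 := H.mean_abs_centred_le hk hx hr hΛ hkr hr1 hδ
    have h6 : 6 * Λ * r * mean μ (fun S => |Real.exp (t * centred μ x S) - m|)
        ≤ 6 * Λ * r * (2 * t * (y + (12 + 42 * Λ) * r)) := by
      gcongr
      exact h4.trans (by gcongr)
    have h7 : 12 * Λ * r * t * y ≤ y / 2 := by nlinarith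
    have h8 : Λ * (12 + 42 * Λ) * (r ^ 2 * t) ≤ Λ * (12 + 42 * Λ) * (q * m) := by
      exact mul_le_mul_of_nonneg_left (hqt.trans hqm) (by positivity)
    nlinarith
  · have h4 : mean μ (fun S => |Real.exp (t * centred μ x S) - m|) ≤ 2 * m := by
      have e1 : mean μ (fun S => |Real.exp (t * centred μ x S) - m|)
          ≤ mean μ (fun S => Real.exp (t * centred μ x S) + m) := by
        refine mean_mono H.nonneg fun S => (abs_sub _ _).trans ?_
        rw [abs_of_pos (Real.exp_pos _), abs_of_pos (by linarith)]
      rw [mean_add, H.mean_const, ← hm] at e1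
      linarith
    have h5 : 6 * Λ * r * mean μ (fun S => |Real.exp (t * centred μ x S) - m|)
        ≤ 6 * Λ * r * (2 * m) := by gcongr
    have h6 : 12 * Λ * r * m * 1 ≤ 12 * Λ * r * m * (24 * Λ * r * t) := by gcongr
    have h7 : Λ ^ 2 * m * (r ^ 2 * t) ≤ Λ ^ 2 * m * q := by gcongr
    nlinarith [mul_nonneg hΛ hΛq]

/-- The Bennett-type bound for linear forms under a nearly exchangeable law. -/
theorem mean_exp_le [Nonempty ι] (H : NearlyExchangeable μ k δ)
    (hk : (Fintype.card ι : ℝ) ≤ 3 * (Fintype.card ι - k)) {x : ι → ℝ}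
    (hx : ∑ i, x i ^ 2 ≤ 1) {K : ℝ} (hK : ∀ i, |x i| ≤ K) (hK0 : 0 < K) {r Λ : ℝ} (hr : 0 < r)
    (hΛ : 0 ≤ Λ) (hkr : (k : ℝ) ≤ Fintype.card ι * r ^ 2) (hr1 : 1 ≤ Fintype.card ι * r ^ 2)
    (hδ : ∑ i, (∑ j, δ i j) ^ 2 ≤ (Λ * Fintype.card ι / r) ^ 2) {γ : ℝ} (hγ : 0 ≤ γ)
    (hγ4 : γ ≤ 1 / 4) (hγC : γ ^ 2 * mgfConst Λ ≤ 1) {t : ℝ} (ht : 0 ≤ t) :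
    mean μ (fun S => Real.exp (γ * t * centred μ x S)) ≤ Real.exp (r ^ 2 / K ^ 2 * g (t * K)) := by
  set m : ℝ → ℝ := fun t => mean μ (fun S => Real.exp (t * centred μ x S)) with hm
  set m' : ℝ → ℝ := fun t => mean μ (fun S => centred μ x S * Real.exp (t * centred μ x S)) with hm'
  set G : ℝ → ℝ := fun t => r ^ 2 / K ^ 2 * g (t * K) with hG
  set G' : ℝ → ℝ := fun t => r ^ 2 / K * (Real.exp (t * K) - 1) with hG'
  have hGd : ∀ s, HasDerivAt G (G' s) s := by
    intro s
    have h1 := (hasDerivAt_id s).mul_const K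
    have h2 := (((h1.exp).sub h1).sub_const 1).const_mul (r ^ 2 / K ^ 2)
    simp only [id, one_mul] at h2
    refine h2.congr_deriv ?_
    simp only [hG']; field_simp
  have hmd : ∀ s, HasDerivAt (fun s => m (γ * s)) (m' (γ * s) * γ) s := by
    intro s
    have h1 := (hasDerivAt_id s).const_mul γ
    rw [mul_one] at h1
    exact (hasDerivAt_mean_exp μ x (γ * s)).comp s h1
  have hF : ∀ s, HasDerivAt (fun s => Real.exp (-G s) * m (γ * s))
      (Real.exp (-G s) * (-G' s) * m (γ * s) + Real.exp (-G s) * (m' (γ * s) * γ)) s :=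
    fun s => ((hGd s).neg.exp).mul (hmd s)
  have hanti : AntitoneOn (fun s => Real.exp (-G s) * m (γ * s)) (Set.Ici 0) := by
    refine antitoneOn_of_deriv_nonpos (convex_Ici 0)
      (fun s _ => (hF s).continuousAt.continuousWithinAt)
      (fun s _ => (hF s).differentiableAt.differentiableWithinAt) fun s hs => ?_
    rw [interior_Ici, Set.mem_Ioi] at hs
    rw [(hF s).deriv]
    have h1 := H.mean_centred_mul_exp_le hk hx hK hr hΛ hkr hr1 hδ (mul_nonneg hγ hs.le)
    have hm1 : 1 ≤ m (γ * s) := H.one_le_mean_exp x (γ * s)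
    change m' (γ * s) ≤ _ * m (γ * s) at h1
    have h2 : m' (γ * s) * γ ≤ G' s * m (γ * s) := by
      have h3 : Real.exp (2 * (γ * s) * K) ≤ Real.exp (s * K / 2) := by
        refine Real.exp_le_exp.2 ?_
        nlinarith [mul_pos hs hK0]
      have h4 := mul_exp_half_le (s * K) (by positivity)
      have h5 : r ^ 2 / K * (s * K * Real.exp (s * K / 2)) ≤ G' s := by
        simp only [hG']; gcongr
      have h6 : r ^ 2 / K * (s * K * Real.exp (s * K / 2))
          = r ^ 2 * s * Real.exp (s * K / 2) := by field_simp
      calc m' (γ * s) * γ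
          ≤ mgfConst Λ * (r ^ 2 * (γ * s) * Real.exp (2 * (γ * s) * K)) * m (γ * s) * γ := by
            gcongr
        _ = (γ ^ 2 * mgfConst Λ) * (r ^ 2 * s * Real.exp (2 * (γ * s) * K)) * m (γ * s) := by ring
        _ ≤ 1 * (r ^ 2 * s * Real.exp (s * K / 2)) * m (γ * s) := by gcongr
        _ ≤ G' s * m (γ * s) := by rw [one_mul, ← h6]; gcongr
    nlinarith [Real.exp_pos (-G s)]
  have h0 := hanti (Set.mem_Ici.2 le_rfl) (Set.mem_Ici.2 ht) ht
  have hG0 : G 0 = 0 := by simp [hG, g]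
  have hm0 : m 0 = 1 := by simp [hm, H.mean_const]
  simp only [mul_zero, hG0, hm0, neg_zero, Real.exp_zero, mul_one, Real.exp_neg] at h0
  rwa [inv_mul_le_iff₀ (Real.exp_pos _), mul_one] at h0

end NearlyExchangeable
end SubsetLaw

/-! ### Switchings that involve the random row -/

section Switching
variable {n : ℕ}

/-- Negation of the four entries of `M` in the rows `r`, `s` and the columns `a`, `b`. -/
def toggle (M : BoolMatrix n) (r s a b : Fin n) : BoolMatrix n :=
  fun x y => if (x = r ∨ x = s) ∧ (y = a ∨ y = b) then !M x y else M x y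

theorem toggle_toggle (M : BoolMatrix n) (r s a b : Fin n) :
    toggle (toggle M r s a b) r s a b = M := by
  funext x y
  by_cases h : (x = r ∨ x = s) ∧ (y = a ∨ y = b) <;> simp [toggle, h]

theorem toggle_comm_cols (M : BoolMatrix n) (r s a b : Fin n) :
    toggle M r s a b = toggle M r s b a := by
  funext x y
  simp only [toggle, or_comm (a := y = a)]

/-- Negating two different entries of a Boolean vector preserves the number of ones. -/
theorem card_filter_eq_of_flip {v w : Fin n → Bool} {a b : Fin n} (hab : v a ≠ v b)
    (ha : w a = !v a) (hb : w b = !v b) (hw : ∀ y, y ≠ a → y ≠ b → w y = v y) :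
    (Finset.univ.filter fun y => w y = true).card
      = (Finset.univ.filter fun y => v y = true).card := by
  have h : ∀ y, w y = v (Equiv.swap a b y) := by
    intro y
    by_cases hya : y = a
    · subst hya
      rw [Equiv.swap_apply_left, ha]
      cases h1 : v y <;> cases h2 : v b <;> simp_all
    by_cases hyb : y = b
    · subst hyb
      rw [Equiv.swap_apply_right, hb]
      cases h1 : v y <;> cases h2 : v a <;> simp_all
    rw [Equiv.swap_apply_of_ne_of_ne hya hyb, hw y hya hyb]
  refine Finset.card_equiv (Equiv.swap a b) fun y => ?_
  simp [h]

variable {din dout : Fin n → ℕ} {m : ℕ} {hmn : m < n} {Y : Fin m → Fin n → Bool}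

theorem toggle_mem_matricesWithRows {M : BoolMatrix n}
    (hM : M ∈ matricesWithRows din dout hmn Y) {r s a b : Fin n} (hr : m ≤ r.val) (hs : m ≤ s.val)
    (hra : M r a ≠ M r b) (hsa : M s a ≠ M s b) (hrs : M r a ≠ M s a) :
    toggle M r s a b ∈ matricesWithRows din dout hmn Y := by
  have hrs' : M r b ≠ M s b := by
    cases h1 : M r a <;> cases h2 : M r b <;> cases h3 : M s a <;> cases h4 : M s b <;> simp_all
  obtain ⟨⟨hc, hr'⟩, hY⟩ := hM
  refine ⟨⟨fun j => ?_, fun i => ?_⟩, fun i => ?_⟩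
  · rw [← hc j]
    by_cases hj : j = a ∨ j = b
    · refine card_filter_eq_of_flip (v := fun i => M i j) (a := r) (b := s) ?_ ?_ ?_ ?_
      · rcases hj with rfl | rfl <;> assumption
      · simp [toggle, hj]
      · simp [toggle, hj]
      · intro y h1 h2; simp [toggle, h1, h2]
    · simp [toggle, hj]
  · rw [← hr' i]
    by_cases hi : i = r ∨ i = s
    · refine card_filter_eq_of_flip (v := fun j => M i j) (a := a) (b := b) ?_ ?_ ?_ ?_
      · rcases hi with rfl | rfl <;> assumption
      · simp [toggle, hi]
      · simp [toggle, hi]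
      · intro y h1 h2; simp [toggle, h1, h2]
    · simp [toggle, hi]
  · rw [← hY i]
    have h1 : Fin.castLE hmn.le i ≠ r := by
      rintro rfl; have := i.isLt; simp at hr; omega
    have h2 : Fin.castLE hmn.le i ≠ s := by
      rintro rfl; have := i.isLt; simp at hs; omega
    funext y; simp [toggle, h1, h2]

/-- The rows below the row with index `m`. -/
def lowerRows (n m : ℕ) : Finset (Fin n) := Finset.univ.filter fun r => m < r.val

/-- The rows below the row with index `m` in which `M` has a one in column `i` and a zero in
column `j`. -/
def differ (m : ℕ) (M : BoolMatrix n) (i j : Fin n) : Finset (Fin n) :=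
  (lowerRows n m).filter fun r => M r i = true ∧ M r j = false

/-- The number of ones of column `l` below the row with index `m`. -/
def lowerCol (m : ℕ) (M : BoolMatrix n) (l : Fin n) : ℕ :=
  ((lowerRows n m).filter fun r => M r l = true).card

open Classical in
/-- The admissible matrices whose row with index `m` is the indicator of `S`. -/
noncomputable def fiber (din dout : Fin n → ℕ) {m : ℕ} (hmn : m < n) (Y : Fin m → Fin n → Bool)
    (S : Finset (Fin n)) : Finset (BoolMatrix n) :=
  Finset.univ.filter fun M =>
    M ∈ matricesWithRows din dout hmn Y ∧ ∀ l, M ⟨m, hmn⟩ l = true ↔ l ∈ S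

theorem mem_fiber {S : Finset (Fin n)} {M : BoolMatrix n} :
    M ∈ fiber din dout hmn Y S ↔
      M ∈ matricesWithRows din dout hmn Y ∧ ∀ l, M ⟨m, hmn⟩ l = true ↔ l ∈ S := by
  simp [fiber]

theorem mem_differ {M : BoolMatrix n} {i j r : Fin n} :
    r ∈ differ m M i j ↔ m < r.val ∧ M r i = true ∧ M r j = false := by
  simp [differ, lowerRows]

theorem card_lowerRows (hmn : m < n) : ((lowerRows n m).card : ℝ) = n - m - 1 := by
  have h : lowerRows n m = Finset.Ioi (⟨m, hmn⟩ : Fin n) := by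
    ext r; simp [lowerRows, Fin.lt_def]
  rw [h, Fin.card_Ioi, Nat.cast_sub (by simp; omega), Nat.cast_sub (by omega)]
  push_cast; ring

/-- The column sums that the rows above leave for the lower rows. -/
theorem lowerCol_eq {S : Finset (Fin n)} {M : BoolMatrix n} (hM : M ∈ fiber din dout hmn Y S)
    (l : Fin n) : (lowerCol m M l : ℝ) = p din Y l - if l ∈ S then 1 else 0 := by
  obtain ⟨⟨⟨hc, -⟩, hY⟩, hS⟩ := mem_fiber.1 hM
  have h1 : (Finset.univ.filter fun i : Fin m => Y i l = true).card
      = (Finset.univ.filter fun r : Fin n => M r l = true ∧ r.val < m).card := by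
    refine Finset.card_bij (fun i _ => Fin.castLE hmn.le i) ?_ ?_ ?_
    · intro i hi
      simp only [Finset.mem_filter, Finset.mem_univ, true_and] at hi ⊢
      exact ⟨by rw [hY i]; exact hi, by simp⟩
    · intro i _ j _ h; exact Fin.castLE_injective _ h
    · intro r hr
      simp only [Finset.mem_filter, Finset.mem_univ, true_and] at hr
      refine ⟨⟨r.val, hr.2⟩, ?_, rfl⟩
      simp only [Finset.mem_filter, Finset.mem_univ, true_and]
      rw [← hY]; exact hr.1
  have h2 : (Finset.univ.filter fun r : Fin n => M r l = true ∧ r.val = m).card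
      = if l ∈ S then 1 else 0 := by
    by_cases hl : l ∈ S
    · rw [if_pos hl, Finset.card_eq_one]
      refine ⟨⟨m, hmn⟩, ?_⟩
      ext r
      simp only [Finset.mem_filter, Finset.mem_univ, true_and, Finset.mem_singleton]
      constructor
      · rintro ⟨-, h⟩; exact Fin.ext h
      · rintro rfl; exact ⟨(hS l).2 hl, rfl⟩
    · rw [if_neg hl, Finset.card_eq_zero, Finset.filter_eq_empty_iff]
      rintro r - ⟨h, h'⟩
      have : r = ⟨m, hmn⟩ := Fin.ext h'
      subst this
      exact hl ((hS l).1 h)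
  have h3 : lowerCol m M l
      = (Finset.univ.filter fun r : Fin n => M r l = true ∧ m < r.val).card := by
    rw [lowerCol, lowerRows, Finset.filter_filter]
    congr 1; ext r; simp [and_comm]
  have h4 : (Finset.univ.filter fun r : Fin n => M r l = true).card
      = (Finset.univ.filter fun r : Fin n => M r l = true ∧ r.val < m).card
        + (Finset.univ.filter fun r : Fin n => M r l = true ∧ r.val = m).card
        + (Finset.univ.filter fun r : Fin n => M r l = true ∧ m < r.val).card := by
    rw [← Finset.card_union_of_disjoint, ← Finset.card_union_of_disjoint]
    · congr 1; ext r
      simp only [Finset.mem_filter, Finset.mem_univ, true_and, Finset.mem_union]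
      have := lt_trichotomy r.val m
      tauto
    · rw [Finset.disjoint_left]; intro r hr hr'
      simp only [Finset.mem_filter, Finset.mem_univ, true_and, Finset.mem_union] at hr hr'
      omega
    · rw [Finset.disjoint_left]; intro r hr hr'
      simp only [Finset.mem_filter, Finset.mem_univ, true_and] at hr hr'
      omega
  rw [hc l, ← h1, h2, ← h3] at h4
  rw [p, h4]
  push_cast; ring

theorem lowerCol_eq_card_add_card_differ (M : BoolMatrix n) (i j : Fin n) :
    lowerCol m M i
      = ((lowerRows n m).filter fun r => M r i = true ∧ M r j = true).card
        + (differ m M i j).card := by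
  rw [lowerCol, differ, ← Finset.card_filter_add_card_filter_not (fun r => M r j = true),
    Finset.filter_filter, Finset.filter_filter]
  simp

theorem card_differ_sub (M : BoolMatrix n) (i j : Fin n) :
    ((differ m M i j).card : ℝ) - (differ m M j i).card = lowerCol m M i - lowerCol m M j := by
  have h1 := lowerCol_eq_card_add_card_differ (m := m) M i j
  have h2 := lowerCol_eq_card_add_card_differ (m := m) M j i
  have h3 : ((lowerRows n m).filter fun r => M r i = true ∧ M r j = true)
      = ((lowerRows n m).filter fun r => M r j = true ∧ M r i = true) := by
    ext r; simp [and_comm]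
  rw [h1, h2, h3]; push_cast; ring

theorem card_lowerRows_eq (M : BoolMatrix n) (i j : Fin n) :
    (lowerRows n m).card = lowerCol m M i + (differ m M j i).card
      + ((lowerRows n m).filter fun r => M r i = false ∧ M r j = false).card := by
  rw [lowerCol, differ, add_assoc, ← Finset.card_filter_add_card_filter_not (fun r => M r i = true)
    (s := lowerRows n m), ← Finset.card_filter_add_card_filter_not (fun r => M r j = true)
    (s := (lowerRows n m).filter fun r => ¬ M r i = true),
    Finset.filter_filter, Finset.filter_filter]
  simp [and_comm]

section RowSwitch

variable {T : Finset (Fin n)} {i j : Fin n}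

/-- Moving a one of the row with index `m` from column `i` to column `j`, compensated in the
lower row `r`. -/
theorem toggle_mem_fiber (hi : i ∉ T) (hj : j ∉ T) (hij : i ≠ j) {M : BoolMatrix n}
    (hM : M ∈ fiber din dout hmn Y (insert i T)) {r : Fin n} (hr : r ∈ differ m M j i) :
    toggle M r ⟨m, hmn⟩ i j ∈ fiber din dout hmn Y (insert j T) ∧
      differ m (toggle M r ⟨m, hmn⟩ i j) j i = (differ m M j i).erase r ∧
      r ∈ differ m (toggle M r ⟨m, hmn⟩ i j) i j := by
  rw [mem_differ] at hr
  obtain ⟨hmr, hrj, hri⟩ := hr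
  obtain ⟨hM1, hM2⟩ := mem_fiber.1 hM
  have hmi : M ⟨m, hmn⟩ i = true := (hM2 i).2 (Finset.mem_insert_self _ _)
  have hmj : M ⟨m, hmn⟩ j = false := by
    rw [← Bool.not_eq_true, hM2 j]; simp [hj, hij.symm]
  refine ⟨mem_fiber.2 ⟨toggle_mem_matricesWithRows hM1 hmr.le le_rfl (by simp [hri, hrj])
    (by simp [hmi, hmj]) (by simp [hri, hmi]), fun l => ?_⟩, ?_, ?_⟩
  · by_cases hl : l = i
    · subst hl; simp [toggle, hmi, hi, hij]
    by_cases hl' : l = j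
    · subst hl'; simp [toggle, hmj]
    have := hM2 l
    simp only [Finset.mem_insert, hl, false_or] at this
    simp [toggle, hl, hl', this]
  · ext s
    rw [Finset.mem_erase, mem_differ, mem_differ]
    by_cases hs : s = r
    · subst hs; simp [toggle, hrj]
    by_cases hs' : s = ⟨m, hmn⟩
    · subst hs'; simp
    simp [toggle, hs, hs']
  · rw [mem_differ]; simp [toggle, hmr, hri, hrj]

/-- Double counting of the switchings between the fibres over `T ∪ {i}` and `T ∪ {j}`, with a
weight that depends on the number of rows in which the two columns disagree. -/
theorem sum_differ_fiber (hi : i ∉ T) (hj : j ∉ T) (hij : i ≠ j) (w : ℕ → ℝ) :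
    ∑ M ∈ fiber din dout hmn Y (insert i T), ∑ _r ∈ differ m M j i, w (differ m M j i).card
      = ∑ M ∈ fiber din dout hmn Y (insert j T), ∑ _r ∈ differ m M i j,
          w ((differ m M j i).card + 1) := by
  rw [Finset.sum_sigma', Finset.sum_sigma']
  refine Finset.sum_bij' (fun q _ => ⟨toggle q.1 q.2 ⟨m, hmn⟩ i j, q.2⟩)
    (fun q _ => ⟨toggle q.1 q.2 ⟨m, hmn⟩ i j, q.2⟩) ?_ ?_ ?_ ?_ ?_
  · rintro ⟨M, r⟩ h
    rw [Finset.mem_sigma] at h ⊢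
    have := toggle_mem_fiber hi hj hij h.1 h.2
    exact ⟨this.1, this.2.2⟩
  · rintro ⟨M, r⟩ h
    rw [Finset.mem_sigma] at h ⊢
    have := toggle_mem_fiber hj hi hij.symm h.1 h.2
    rw [toggle_comm_cols] at this
    exact ⟨this.1, this.2.2⟩
  · rintro ⟨M, r⟩ h; simp [toggle_toggle]
  · rintro ⟨M, r⟩ h; simp [toggle_toggle]
  · rintro ⟨M, r⟩ h
    rw [Finset.mem_sigma] at h
    have := toggle_mem_fiber hi hj hij h.1 h.2
    dsimp only at this h ⊢
    rw [this.2.1, Finset.card_erase_add_one h.2]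

/-- The exact relation between the sizes of two neighbouring fibres. The weight `1 / (b + Δ)`
makes the sum over the switchings that end in a given matrix equal to one. -/
theorem sum_fiber_div (hi : i ∉ T) (hj : j ∉ T) (hij : i ≠ j)
    (hp : p din Y j ≤ p din Y i) :
    ∑ M ∈ fiber din dout hmn Y (insert i T),
        ((differ m M j i).card : ℝ) / ((differ m M j i).card + (p din Y i - p din Y j))
      = (fiber din dout hmn Y (insert j T)).card := by
  have h := sum_differ_fiber (din := din) (dout := dout) (hmn := hmn) (Y := Y) hi hj hij
    (fun b => 1 / ((b : ℝ) + (p din Y i - p din Y j)))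
  simp only [Finset.sum_const, nsmul_eq_mul] at h
  simp only [mul_one_div] at h
  rw [h, Finset.card_eq_sum_ones]
  push_cast
  refine Finset.sum_congr rfl fun M hM => ?_
  have h1 := card_differ_sub (m := m) M i j
  rw [lowerCol_eq hM, lowerCol_eq hM, if_pos (Finset.mem_insert_self j T),
    if_neg (by simp [hi, hij])] at h1
  have h2 : ((differ m M i j).card : ℝ)
      = (differ m M j i).card + 1 + (p din Y i - p din Y j) := by linarith
  rw [h2]
  have : (0 : ℝ) ≤ (differ m M j i).card := Nat.cast_nonneg _
  exact div_self (by linarith)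

end RowSwitch

/-! ### Switchings between lower rows -/

/-- The lower rows in which `M` has ones in the columns `i`, `j` and a zero in column `l`. -/
def commonOnes (m : ℕ) (M : BoolMatrix n) (i j l : Fin n) : Finset (Fin n) :=
  (lowerRows n m).filter fun r => (M r i = true ∧ M r j = true) ∧ M r l = false

/-- The lower rows in which `M` has zeros in the columns `i`, `j` and a one in column `l`. -/
def commonZeros (m : ℕ) (M : BoolMatrix n) (i j l : Fin n) : Finset (Fin n) :=
  (lowerRows n m).filter fun r => (M r i = false ∧ M r j = false) ∧ M r l = true

theorem mem_commonOnes {M : BoolMatrix n} {i j l r : Fin n} :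
    r ∈ commonOnes m M i j l ↔ m < r.val ∧ (M r i = true ∧ M r j = true) ∧ M r l = false := by
  simp [commonOnes, lowerRows]

theorem mem_commonZeros {M : BoolMatrix n} {i j l r : Fin n} :
    r ∈ commonZeros m M i j l ↔ m < r.val ∧ (M r i = false ∧ M r j = false) ∧ M r l = true := by
  simp [commonZeros, lowerRows]

/-- Exchanging the ones of the columns `j` and `l` in two lower rows `r`, `s` such that `i` and `j`
agree in both: afterwards they disagree, in opposite ways. -/
theorem toggle_lower_mem_fiber {S : Finset (Fin n)} {i j l r s : Fin n} (hij : i ≠ j)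
    {M : BoolMatrix n} (hM : M ∈ fiber din dout hmn Y S) (hr : r ∈ commonOnes m M i j l)
    (hs : s ∈ commonZeros m M i j l) :
    toggle M r s j l ∈ fiber din dout hmn Y S ∧
      differ m (toggle M r s j l) j i = insert s (differ m M j i) ∧ s ∉ differ m M j i ∧
      r ∈ differ m (toggle M r s j l) i j ∧ toggle M r s j l r l = true := by
  rw [mem_commonOnes] at hr
  rw [mem_commonZeros] at hs
  obtain ⟨hmr, ⟨hri, hrj⟩, hrl⟩ := hr
  obtain ⟨hms, ⟨hsi, hsj⟩, hsl⟩ := hs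
  obtain ⟨hM1, hM2⟩ := mem_fiber.1 hM
  have hil : i ≠ l := by rintro rfl; simp [hri] at hrl
  have hrm : (⟨m, hmn⟩ : Fin n) ≠ r := by rintro rfl; simp at hmr
  have hsm : (⟨m, hmn⟩ : Fin n) ≠ s := by rintro rfl; simp at hms
  refine ⟨mem_fiber.2 ⟨toggle_mem_matricesWithRows hM1 hmr.le hms.le (by simp [hrj, hrl])
    (by simp [hsj, hsl]) (by simp [hrj, hsj]), fun y => ?_⟩, ?_, ?_, ?_, ?_⟩
  · rw [← hM2 y]; simp [toggle, hrm, hsm]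
  · ext y
    rw [Finset.mem_insert, mem_differ, mem_differ]
    by_cases hys : y = s
    · subst hys; simp [toggle, hij, hil, hms, hsi, hsj]
    by_cases hyr : y = r
    · subst hyr; simp [toggle, hij, hil, hri, hys]
    simp [toggle, hys, hyr]
  · simp [mem_differ, hsj]
  · rw [mem_differ]; simp [toggle, hij, hil, hmr, hri, hrj]
  · simp [toggle, hrl]

/-- Double counting of the switchings of two lower rows. The right-hand side bounds, for each
matrix, the number of pairs of rows and columns from which it can arise. -/
theorem sum_commonOnes_mul_commonZeros_le {S : Finset (Fin n)} {i j : Fin n} (hij : i ≠ j)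
    {w : ℕ → ℝ} (hw : ∀ b, 0 ≤ w b) :
    ∑ M ∈ fiber din dout hmn Y S, w (differ m M j i).card *
        ∑ l, ((commonOnes m M i j l).card : ℝ) * (commonZeros m M i j l).card
      ≤ ∑ M ∈ fiber din dout hmn Y S, w ((differ m M j i).card - 1) *
        ∑ r ∈ differ m M i j, ((differ m M j i).card : ℝ)
          * (Finset.univ.filter fun l => M r l = true).card := by
  set A : Finset (Σ _ : BoolMatrix n, Σ _ : Fin n, Fin n × Fin n) :=
    (fiber din dout hmn Y S).sigma fun M => Finset.univ.sigma fun l =>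
      commonOnes m M i j l ×ˢ commonZeros m M i j l with hA
  set B : Finset (Σ _ : BoolMatrix n, Σ _ : Fin n, Fin n × Fin n) :=
    (fiber din dout hmn Y S).sigma fun M => (differ m M i j).sigma fun r =>
      differ m M j i ×ˢ (Finset.univ.filter fun l => M r l = true) with hB
  have h1 : ∑ M ∈ fiber din dout hmn Y S, w (differ m M j i).card *
        ∑ l, ((commonOnes m M i j l).card : ℝ) * (commonZeros m M i j l).card
      = ∑ q ∈ A, w (differ m q.1 j i).card := by
    rw [hA, Finset.sum_sigma]
    refine Finset.sum_congr rfl fun M _ => ?_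
    simp only [Finset.sum_const, Finset.card_sigma, Finset.card_product, nsmul_eq_mul]
    push_cast; ring
  have h2 : ∑ M ∈ fiber din dout hmn Y S, w ((differ m M j i).card - 1) *
        ∑ r ∈ differ m M i j, ((differ m M j i).card : ℝ)
          * (Finset.univ.filter fun l => M r l = true).card
      = ∑ q ∈ B, w ((differ m q.1 j i).card - 1) := by
    rw [hB, Finset.sum_sigma]
    refine Finset.sum_congr rfl fun M _ => ?_
    simp only [Finset.sum_const, Finset.card_sigma, Finset.card_product, nsmul_eq_mul]
    push_cast; ring
  rw [h1, h2]
  let e : (Σ _ : BoolMatrix n, Σ _ : Fin n, Fin n × Fin n)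
      → (Σ _ : BoolMatrix n, Σ _ : Fin n, Fin n × Fin n) :=
    fun q => ⟨toggle q.1 q.2.2.1 q.2.2.2 j q.2.1, q.2.2.1, q.2.2.2, q.2.1⟩
  have he : Set.InjOn e A := by
    rintro ⟨M, l, r, s⟩ - ⟨M', l', r', s'⟩ - h
    simp only [e, Sigma.mk.injEq, heq_eq_eq, Prod.mk.injEq] at h
    obtain ⟨h, rfl, rfl, rfl⟩ := h
    have := congrArg (fun N => toggle N r s j l) h
    simp only [toggle_toggle] at this
    rw [this]
  have hmem : ∀ q ∈ A, e q ∈ B ∧ (differ m (e q).1 j i).card - 1 = (differ m q.1 j i).card := by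
    rintro ⟨M, l, r, s⟩ hq
    simp only [hA, Finset.mem_sigma, Finset.mem_univ, true_and, Finset.mem_product] at hq
    obtain ⟨hM, hr, hs⟩ := hq
    obtain ⟨g1, g2, g3, g4, g5⟩ := toggle_lower_mem_fiber hij hM hr hs
    constructor
    · simp only [hB, e, Finset.mem_sigma, Finset.mem_product, Finset.mem_filter, Finset.mem_univ,
        true_and]
      exact ⟨g1, g4, by rw [g2]; exact Finset.mem_insert_self _ _, g5⟩
    · simp only [e]
      rw [g2, Finset.card_insert_of_notMem g3, Nat.add_sub_cancel]
  calc ∑ q ∈ A, w (differ m q.1 j i).card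
      = ∑ q ∈ A, w ((differ m (e q).1 j i).card - 1) :=
        Finset.sum_congr rfl fun q hq => by rw [(hmem q hq).2]
    _ = ∑ q ∈ A.image e, w ((differ m q.1 j i).card - 1) := by rw [Finset.sum_image he]
    _ ≤ _ := by
        refine Finset.sum_le_sum_of_subset_of_nonneg ?_ fun _ _ _ => hw _
        intro q hq
        obtain ⟨q', hq', rfl⟩ := Finset.mem_image.1 hq
        exact (hmem q' hq').1

section Estimates

variable {d : ℕ} {S : Finset (Fin n)} {i j : Fin n}

/-- If the columns `i`, `j` disagree in few lower rows, there are order `n d ^ 2` switchings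
that make them disagree in one more row. -/
theorem le_sum_commonOnes_mul_commonZeros
    (hdin : ∀ i, din i ≤ d) (hdout : ∀ i, (1 - c₀) * (d : ℝ) ≤ dout i)
    (hdn : (d : ℝ) ≤ (1 / 2 + c₀) * n) (hm : (m : ℝ) ≤ c₀ * n)
    (hpi : p din Y i ≤ d) (hpj : (997 / 1000) * (d : ℝ) ≤ p din Y j)
    (hi : i ∈ S) (hj : j ∉ S) {M : BoolMatrix n} (hM : M ∈ fiber din dout hmn Y S)
    (hb : ((differ m M j i).card : ℝ) < d / 10) :
    (14 / 100) * (n * (d : ℝ) ^ 2)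
      ≤ ∑ l, ((commonOnes m M i j l).card : ℝ) * (commonZeros m M i j l).card := by
  obtain ⟨⟨⟨hcol, hrow⟩, -⟩, -⟩ := mem_fiber.1 hM
  set R := (lowerRows n m).filter fun r => M r i = true ∧ M r j = true with hR
  set R' := (lowerRows n m).filter fun r => M r i = false ∧ M r j = false with hR'
  set b : ℝ := ((differ m M j i).card : ℝ)
  have hn0 : (0 : ℝ) ≤ n := Nat.cast_nonneg n
  have hd0 : (0 : ℝ) ≤ d := Nat.cast_nonneg d
  have hRcard : (R.card : ℝ) = p din Y j - b := by
    have h1 := lowerCol_eq_card_add_card_differ (m := m) M j i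
    have h2 := lowerCol_eq hM j
    rw [if_neg hj, sub_zero, h1] at h2
    have h3 : ((lowerRows n m).filter fun r => M r j = true ∧ M r i = true) = R := by
      ext r; simp [hR, and_comm]
    rw [h3] at h2
    push_cast at h2
    linarith
  have hR'card : (44 / 100) * (n : ℝ) ≤ R'.card := by
    have h1 := card_lowerRows_eq (m := m) M i j
    have h2 := lowerCol_eq hM i
    rw [if_pos hi] at h2
    have h3 := card_lowerRows hmn
    rw [h1] at h3
    push_cast at h3
    unfold c₀ at hdn hm
    change _ + b + (R'.card : ℝ) = _ at h3
    linarith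
  have hones : ∀ l, ((commonZeros m M i j l).card : ℝ) - 103 / 1000 * d
      ≤ (commonOnes m M i j l).card := by
    intro l
    have h1 : (R.filter fun r => M r l = true).card + (commonOnes m M i j l).card = R.card := by
      rw [← Finset.card_filter_add_card_filter_not (s := R) (fun r => M r l = true)]
      congr 2
      rw [hR, commonOnes, Finset.filter_filter]
      simp
    have h2 : (R.filter fun r => M r l = true).card + (commonZeros m M i j l).card ≤ d := by
      rw [← Finset.card_union_of_disjoint]
      · refine le_trans (Finset.card_le_card ?_) ((hcol l).le.trans (hdin l))
        intro r hr
        rw [Finset.mem_union, Finset.mem_filter, mem_commonZeros] at hr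
        simp only [Finset.mem_filter, Finset.mem_univ, true_and]
        rcases hr with hr | hr
        · exact hr.2
        · exact hr.2.2
      · rw [Finset.disjoint_left]
        intro r hr hr'
        simp only [hR, Finset.mem_filter] at hr
        rw [mem_commonZeros] at hr'
        simp [hr.1.2.1] at hr'
    have h1' : ((R.filter fun r => M r l = true).card : ℝ) + (commonOnes m M i j l).card
        = R.card := by exact_mod_cast h1
    have h2' : ((R.filter fun r => M r l = true).card : ℝ) + (commonZeros m M i j l).card
        ≤ d := by exact_mod_cast h2
    linarith
  have hsum : ∑ l, ((commonZeros m M i j l).card : ℝ) = ∑ r ∈ R', (dout r : ℝ) := by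
    have h1 : ∑ l, (commonZeros m M i j l).card = ∑ r ∈ R', dout r := by
      have h2 := Finset.sum_card_bipartiteAbove_eq_sum_card_bipartiteBelow
        (s := R') (t := (Finset.univ : Finset (Fin n))) (fun r l => M r l = true)
      simp only [Finset.bipartiteAbove, Finset.bipartiteBelow, hrow] at h2
      rw [h2]
      refine Finset.sum_congr rfl fun l _ => ?_
      rw [hR', commonZeros, Finset.filter_filter]
    exact_mod_cast h1
  have hW : (439 / 1000) * ((n : ℝ) * d) ≤ ∑ l, ((commonZeros m M i j l).card : ℝ) := by
    rw [hsum]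
    have h1 := Finset.card_nsmul_le_sum R' (fun r => (dout r : ℝ)) ((1 - c₀) * d)
      fun r _ => hdout r
    rw [nsmul_eq_mul] at h1
    refine le_trans ?_ h1
    unfold c₀
    nlinarith
  -- `t (t - a) ≥ (2 s - a) t - s ^ 2` with `s` close to the average of the `t`'s
  have hterm : ∀ l, (697 / 1000) * (d : ℝ) * (commonZeros m M i j l).card
      - (16 / 100) * (d : ℝ) ^ 2
      ≤ ((commonOnes m M i j l).card : ℝ) * (commonZeros m M i j l).card := by
    intro l
    have h1 := mul_le_mul_of_nonneg_right (hones l)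
      (Nat.cast_nonneg (commonZeros m M i j l).card : (0 : ℝ) ≤ _)
    nlinarith [sq_nonneg (((commonZeros m M i j l).card : ℝ) - 4 / 10 * d)]
  have h2 := Finset.sum_le_sum fun l (_ : l ∈ Finset.univ) => hterm l
  rw [Finset.sum_sub_distrib, ← Finset.mul_sum] at h2
  simp only [Finset.sum_const, Finset.card_univ, Fintype.card_fin, nsmul_eq_mul] at h2
  have h3 := mul_le_mul_of_nonneg_left hW (by positivity : (0:ℝ) ≤ 697 / 1000 * d)
  have h4 : 0 ≤ (n : ℝ) * (d : ℝ) ^ 2 := by positivity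
  nlinarith

/-- On average over a fibre, the columns `i` and `j` disagree in order `d` lower rows. -/
theorem sum_inv_card_differ_le (hd : 0 < d)
    (hdin : ∀ i, din i ≤ d) (hdout : ∀ i, (1 - c₀) * (d : ℝ) ≤ dout i) (hdout' : ∀ i, dout i ≤ d)
    (hdn : (d : ℝ) ≤ (1 / 2 + c₀) * n) (hm : (m : ℝ) ≤ c₀ * n)
    (hpi : p din Y i ≤ d) (hpj : (997 / 1000) * (d : ℝ) ≤ p din Y j)
    (hi : i ∈ S) (hj : j ∉ S) :
    ∑ M ∈ fiber din dout hmn Y S, 1 / (((differ m M j i).card : ℝ) + 1)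
      ≤ 11 / d * (fiber din dout hmn Y S).card := by
  have hd0 : (0 : ℝ) < d := by exact_mod_cast hd
  have hn0 : (0 : ℝ) < n := by unfold c₀ at hdn; linarith
  have hij : i ≠ j := by rintro rfl; exact hj hi
  -- the weight `1 / (b + 1)` cancels the factor `b + 1` in the number of inverse switchings
  let w : ℕ → ℝ := fun b => if (b : ℝ) < d / 10 then 1 / ((b : ℝ) + 1) else 0
  have hw : ∀ b, 0 ≤ w b := by
    intro b; simp only [w]; split_ifs <;> positivity
  have h1 := sum_commonOnes_mul_commonZeros_le (din := din) (dout := dout) (hmn := hmn) (Y := Y)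
    (S := S) hij hw
  have h2 : ∑ M ∈ fiber din dout hmn Y S, w (differ m M j i).card * (14 / 100 * (n * (d : ℝ) ^ 2))
      ≤ ∑ M ∈ fiber din dout hmn Y S, w (differ m M j i).card *
        ∑ l, ((commonOnes m M i j l).card : ℝ) * (commonZeros m M i j l).card := by
    refine Finset.sum_le_sum fun M hM => ?_
    by_cases hb : ((differ m M j i).card : ℝ) < d / 10
    · exact mul_le_mul_of_nonneg_left
        (le_sum_commonOnes_mul_commonZeros hdin hdout hdn hm hpi hpj hi hj hM hb) (hw _)
    · simp [w, hb]
  have h3 : ∑ M ∈ fiber din dout hmn Y S, w ((differ m M j i).card - 1) *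
        ∑ r ∈ differ m M i j, ((differ m M j i).card : ℝ)
          * (Finset.univ.filter fun l => M r l = true).card
      ≤ ∑ M ∈ fiber din dout hmn Y S, (103 / 1000) * (d : ℝ) ^ 2 := by
    refine Finset.sum_le_sum fun M hM => ?_
    obtain ⟨⟨⟨-, hrow⟩, -⟩, -⟩ := mem_fiber.1 hM
    rcases Nat.eq_zero_or_pos (differ m M j i).card with h0 | h0
    · simp only [h0]; simp
    obtain ⟨c, hc⟩ : ∃ c, (differ m M j i).card = c + 1 := ⟨_, (Nat.succ_pred_eq_of_pos h0).symm⟩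
    have h4 := card_differ_sub (m := m) M i j
    rw [lowerCol_eq hM, lowerCol_eq hM, if_pos hi, if_neg hj] at h4
    rw [hc, Nat.add_sub_cancel]
    rw [hc] at h4
    push_cast at h4 ⊢
    by_cases hcd : (c : ℝ) < d / 10
    · simp only [w, if_pos hcd]
      have h5 : ∑ r ∈ differ m M i j, ((c : ℝ) + 1)
          * (Finset.univ.filter fun l => M r l = true).card
          ≤ ∑ r ∈ differ m M i j, ((c : ℝ) + 1) * d := by
        refine Finset.sum_le_sum fun r _ => ?_
        rw [hrow r]
        have : (dout r : ℝ) ≤ d := by exact_mod_cast hdout' r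
        gcongr
      rw [Finset.sum_const, nsmul_eq_mul] at h5
      calc _ ≤ 1 / ((c : ℝ) + 1) * (((differ m M i j).card : ℝ) * (((c : ℝ) + 1) * d)) := by
            gcongr
        _ = ((differ m M i j).card : ℝ) * d := by field_simp
        _ ≤ (103 / 1000 * d) * d := by gcongr; linarith
        _ = _ := by ring
    · simp only [w, if_neg hcd, zero_mul]; positivity
  have h4 : ∑ M ∈ fiber din dout hmn Y S, w (differ m M j i).card
      ≤ 1 / d * (fiber din dout hmn Y S).card := by
    have h5 := h2.trans (h1.trans h3)
    rw [← Finset.sum_mul, Finset.sum_const, nsmul_eq_mul] at h5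
    set W := ∑ M ∈ fiber din dout hmn Y S, w (differ m M j i).card
    set F : ℝ := ((fiber din dout hmn Y S).card : ℝ)
    have hF : 0 ≤ F := Nat.cast_nonneg _
    have h6 : d ^ 2 * (W * (14 / 100 * n)) ≤ d ^ 2 * (F * (103 / 1000)) := by linarith
    have h7 := le_of_mul_le_mul_left h6 (by positivity)
    have hW : 0 ≤ W := Finset.sum_nonneg fun _ _ => hw _
    rw [one_div, inv_mul_eq_div, le_div_iff₀ hd0]
    unfold c₀ at hdn
    nlinarith
  have h5 : ∀ M ∈ fiber din dout hmn Y S, 1 / (((differ m M j i).card : ℝ) + 1)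
      ≤ w (differ m M j i).card + 10 / d := by
    intro M _
    by_cases hb : ((differ m M j i).card : ℝ) < d / 10
    · simp only [w, if_pos hb]; have : (0 : ℝ) < 10 / d := by positivity
      linarith
    · simp only [w, if_neg hb, zero_add]
      rw [not_lt] at hb
      rw [div_le_div_iff₀ (by positivity) hd0]
      linarith
  have h6 := Finset.sum_le_sum h5
  rw [Finset.sum_add_distrib, Finset.sum_const, nsmul_eq_mul] at h6
  calc _ ≤ _ := h6
    _ ≤ 1 / d * (fiber din dout hmn Y S).card + (fiber din dout hmn Y S).card * (10 / d) := by
        linarith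
    _ = _ := by ring

/-- Fibres over two rows that differ by exchanging one element have nearly the same size. -/
theorem abs_card_fiber_sub_le {T : Finset (Fin n)} (hd : 0 < d)
    (hdin : ∀ i, din i ≤ d) (hdout : ∀ i, (1 - c₀) * (d : ℝ) ≤ dout i) (hdout' : ∀ i, dout i ≤ d)
    (hdn : (d : ℝ) ≤ (1 / 2 + c₀) * n) (hm : (m : ℝ) ≤ c₀ * n)
    (hp : ∀ l, p din Y l ≤ d ∧ (997 / 1000) * (d : ℝ) ≤ p din Y l)
    (hi : i ∉ T) (hj : j ∉ T) :
    |((fiber din dout hmn Y (insert i T)).card : ℝ) - (fiber din dout hmn Y (insert j T)).card|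
      ≤ 12 * |p din Y i - p din Y j| / d * (fiber din dout hmn Y (insert j T)).card := by
  have hd0 : (0 : ℝ) < d := by exact_mod_cast hd
  by_cases hij : i = j
  · subst hij; simp
  have key : ∀ i j : Fin n, i ∉ T → j ∉ T → i ≠ j → p din Y j ≤ p din Y i →
      ((fiber din dout hmn Y (insert j T)).card : ℝ) ≤ (fiber din dout hmn Y (insert i T)).card ∧
      ((fiber din dout hmn Y (insert i T)).card : ℝ) - (fiber din dout hmn Y (insert j T)).card
        ≤ 11 * (p din Y i - p din Y j) / d * (fiber din dout hmn Y (insert i T)).card := by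
    intro i j hi hj hij hle
    have h1 := sum_fiber_div (dout := dout) (hmn := hmn) hi hj hij hle
    set F := fiber din dout hmn Y (insert i T)
    have h0 : ∀ M : BoolMatrix n, (0 : ℝ) ≤ (differ m M j i).card := fun M => Nat.cast_nonneg _
    have h2 : ∀ M ∈ F, 0 ≤ 1 - ((differ m M j i).card : ℝ)
          / ((differ m M j i).card + (p din Y i - p din Y j)) ∧
        1 - ((differ m M j i).card : ℝ) / ((differ m M j i).card + (p din Y i - p din Y j))
          ≤ (p din Y i - p din Y j) * (1 / (((differ m M j i).card : ℝ) + 1)) := by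
      intro M hM
      have h3 := card_differ_sub (m := m) M i j
      rw [lowerCol_eq hM, lowerCol_eq hM, if_pos (Finset.mem_insert_self i T),
        if_neg (by simp [hj, hij.symm])] at h3
      have ha : (0 : ℝ) ≤ (differ m M i j).card := Nat.cast_nonneg _
      have hpos : 0 < ((differ m M j i).card : ℝ) + (p din Y i - p din Y j) := by linarith
      rw [one_sub_div hpos.ne', add_sub_cancel_left, mul_one_div]
      refine ⟨div_nonneg (by linarith) hpos.le, ?_⟩
      rcases hle.eq_or_lt with he | hlt
      · simp [he]
      -- the difference of the two column sums is a positive integer, hence at least one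
      have h4 : (differ m M j i).card < (differ m M i j).card + 1 := by
        have : ((differ m M j i).card : ℝ) < (differ m M i j).card + 1 := by linarith
        exact_mod_cast this
      have h5 : ((differ m M j i).card : ℝ) ≤ (differ m M i j).card := by
        exact_mod_cast Nat.lt_succ_iff.1 h4
      have h6 := h0 M
      gcongr
      linarith
    have h3 : (F.card : ℝ) - (fiber din dout hmn Y (insert j T)).card
        = ∑ M ∈ F, (1 - ((differ m M j i).card : ℝ)
          / ((differ m M j i).card + (p din Y i - p din Y j))) := by
      rw [Finset.sum_sub_distrib, h1]; simp
    refine ⟨?_, ?_⟩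
    · have := Finset.sum_nonneg fun M hM => (h2 M hM).1
      linarith
    · rw [h3]
      refine (Finset.sum_le_sum fun M hM => (h2 M hM).2).trans ?_
      rw [← Finset.mul_sum]
      have h4 := sum_inv_card_differ_le (hmn := hmn) hd hdin hdout hdout' hdn hm (hp i).1 (hp j).2
        (Finset.mem_insert_self i T) (show j ∉ insert i T by simp [hj, hij.symm])
      calc _ ≤ (p din Y i - p din Y j) * (11 / d * F.card) := by
            gcongr
        _ = _ := by ring
  have hd1 : ∀ i j : Fin n, p din Y i - p din Y j ≤ 3 / 1000 * d := fun i j => by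
    linarith [(hp i).1, (hp j).2]
  rcases le_total (p din Y j) (p din Y i) with h | h
  · obtain ⟨h1, h2⟩ := key i j hi hj hij h
    rw [abs_of_nonneg (by linarith), abs_of_nonneg (by linarith)]
    have h3 := hd1 i j
    set u := (p din Y i - p din Y j) / d with hu
    have hu0 : 0 ≤ u := div_nonneg (by linarith) hd0.le
    have hu1 : u ≤ 3 / 1000 := by rw [hu, div_le_iff₀ hd0]; linarith
    rw [mul_div_assoc] at h2 ⊢
    rw [← hu] at h2 ⊢
    set A := ((fiber din dout hmn Y (insert i T)).card : ℝ)
    set B := ((fiber din dout hmn Y (insert j T)).card : ℝ)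
    have hB : 0 ≤ B := Nat.cast_nonneg _
    have h4 : A ≤ 12 / 11 * B := by nlinarith
    nlinarith
  · obtain ⟨h1, h2⟩ := key j i hj hi (Ne.symm hij) h
    rw [abs_of_nonpos (by linarith), abs_of_nonpos (by linarith), neg_sub, neg_sub]
    refine h2.trans ?_
    have : 0 ≤ p din Y j - p din Y i := by linarith
    gcongr
    norm_num

end Estimates
end Switching

/-! ### The law of the row -/

section Law
variable {n : ℕ} {din dout : Fin n → ℕ} {m : ℕ} {hmn : m < n} {Y : Fin m → Fin n → Bool}

theorem rowLaw_eq_map_uniformOn :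
    rowLaw din dout hmn Y
      = (uniformOn (matricesWithRows din dout hmn Y)).map fun M : BoolMatrix n => M ⟨m, hmn⟩ := by
  have hsub : matrices din dout ∩ matricesWithRows din dout hmn Y
      = matricesWithRows din dout hmn Y := Set.inter_eq_right.2 fun M hM => hM.1
  rw [rowLaw, uniformOn, uniformOn, cond_cond_eq_cond_inter (Set.toFinite _).measurableSet
    (Set.toFinite _).measurableSet, hsub]

theorem isProbabilityMeasure_rowLaw (h : (matricesWithRows din dout hmn Y).Nonempty) :
    IsProbabilityMeasure (rowLaw din dout hmn Y) := by
  rw [rowLaw_eq_map_uniformOn]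
  have := isProbabilityMeasure_uniformOn (Set.toFinite (matricesWithRows din dout hmn Y)) h
  exact Measure.isProbabilityMeasure_map (measurable_pi_apply _).aemeasurable

/-- The indicator vector of a set of columns. -/
def boolIndicator (S : Finset (Fin n)) : Fin n → Bool := fun l => decide (l ∈ S)

/-- The weight `ℙ(v = 1_S)` of a set `S` of columns under the law of the row `v`. -/
noncomputable def rowWeight (din dout : Fin n → ℕ) {m : ℕ} (hmn : m < n)
    (Y : Fin m → Fin n → Bool) (S : Finset (Fin n)) : ℝ :=
  (rowLaw din dout hmn Y).real {boolIndicator S}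

theorem rowWeight_eq (S : Finset (Fin n)) :
    rowWeight din dout hmn Y S
      = ((matricesWithRows din dout hmn Y).ncard : ℝ)⁻¹ * (fiber din dout hmn Y S).card := by
  have hpre : matricesWithRows din dout hmn Y
      ∩ (fun M : BoolMatrix n => M ⟨m, hmn⟩) ⁻¹' {boolIndicator S}
      = (fiber din dout hmn Y S : Set (BoolMatrix n)) := by
    ext M
    rw [Finset.mem_coe, mem_fiber, Set.mem_inter_iff, Set.mem_preimage, Set.mem_singleton_iff,
      funext_iff]
    refine and_congr_right fun _ => forall_congr' fun l => ?_
    by_cases hl : l ∈ S <;> simp [boolIndicator, hl]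
  have hfin := Set.toFinite (matricesWithRows din dout hmn Y)
  rw [rowWeight, rowLaw_eq_map_uniformOn, map_measureReal_apply (measurable_pi_apply _)
    (measurableSet_singleton _), measureReal_def, uniformOn, cond_apply hfin.measurableSet, hpre,
    Measure.count_apply_finset, Measure.count_apply_finite _ hfin,
    Set.ncard_eq_toFinset_card _ hfin]
  simp

theorem integral_rowLaw (F : (Fin n → Bool) → ℝ) :
    ∫ v, F v ∂(rowLaw din dout hmn Y)
      = mean (rowWeight din dout hmn Y) fun S => F (boolIndicator S) := by
  have : IsFiniteMeasure (rowLaw din dout hmn Y) := by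
    rw [rowLaw_eq_map_uniformOn]
    have : IsFiniteMeasure (uniformOn (matricesWithRows din dout hmn Y)) := by
      unfold uniformOn; infer_instance
    infer_instance
  rw [integral_fintype .of_finite, mean]
  refine Finset.sum_bij' (fun v _ => Finset.univ.filter fun l => v l = true)
    (fun S _ => boolIndicator S) (by simp) (by simp) ?_ ?_ ?_
  · intro v _; funext l; simp [boolIndicator]
  · intro S _; ext l; simp [boolIndicator]
  · intro v _
    have : boolIndicator (Finset.univ.filter fun l => v l = true) = v := by
      funext l; simp [boolIndicator]
    rw [rowWeight, this, smul_eq_mul]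

theorem inner_zeroOne_boolIndicator (x : EuclideanSpace ℝ (Fin n)) (S : Finset (Fin n)) :
    inner ℝ (zeroOne (boolIndicator S)) x = linForm x S := by
  simp [zeroOne, boolIndicator, linForm, PiLp.inner_apply, Finset.sum_ite_mem]

/-- The moment generating function of `eta` as a sum over sets of columns. -/
theorem integral_exp_eta (x : EuclideanSpace ℝ (Fin n)) (c : ℝ) :
    ∫ v, Real.exp (c * eta (rowLaw din dout hmn Y) x v) ∂(rowLaw din dout hmn Y)
      = mean (rowWeight din dout hmn Y)
          fun S => Real.exp (c * centred (rowWeight din dout hmn Y) x S) := by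
  rw [integral_rowLaw]
  simp only [eta, integral_rowLaw, inner_zeroOne_boolIndicator, centred]

theorem sum_rowWeight (h : (matricesWithRows din dout hmn Y).Nonempty) :
    ∑ S, rowWeight din dout hmn Y S = 1 := by
  have := isProbabilityMeasure_rowLaw h
  have h1 := integral_rowLaw (din := din) (dout := dout) (hmn := hmn) (Y := Y) fun _ => 1
  simpa [mean] using h1.symm

theorem card_eq_of_rowWeight_ne_zero {S : Finset (Fin n)}
    (hS : rowWeight din dout hmn Y S ≠ 0) : S.card = dout ⟨m, hmn⟩ := by
  rw [rowWeight_eq] at hS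
  have h1 : (fiber din dout hmn Y S).Nonempty := by
    rw [Finset.nonempty_iff_ne_empty]
    rintro h; simp [h] at hS
  obtain ⟨M, hM⟩ := h1
  obtain ⟨⟨⟨-, hrow⟩, -⟩, hl⟩ := mem_fiber.1 hM
  rw [← hrow]
  congr 1; ext l; simp [hl]

/-- The second moment of a vector whose Orlicz norm is at most `t`. -/
theorem sum_sq_le_of_psiNorm_le (hn : 0 < n) {y : Fin n → ℝ} {t : ℝ} (ht : 0 < t)
    (h : psiNorm y ≤ t) : ∑ i, y i ^ 2 ≤ 2 * Real.exp 1 * n * (2 * t) ^ 2 := by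
  have hn0 : (0 : ℝ) < n := by exact_mod_cast hn
  have he := Real.exp_pos 1
  -- the set in the definition of the norm is nonempty, so that its infimum is not a junk value
  have hne : {t : ℝ | 0 < t ∧
      1 / (Real.exp 1 * (n : ℝ)) * ∑ i, Real.exp (|y i| / t) ≤ 1}.Nonempty := by
    refine ⟨‖y‖ + 1, by positivity, ?_⟩
    have h1 : ∑ i, Real.exp (|y i| / (‖y‖ + 1)) ≤ ∑ _i : Fin n, Real.exp 1 := by
      refine Finset.sum_le_sum fun i _ => Real.exp_le_exp.2 ?_
      rw [div_le_one (by positivity)]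
      have := norm_le_pi_norm y i
      rw [Real.norm_eq_abs] at this
      linarith
    simp only [Finset.sum_const, Finset.card_univ, Fintype.card_fin, nsmul_eq_mul] at h1
    rw [one_div, inv_mul_le_iff₀ (by positivity)]
    linarith
  obtain ⟨s, ⟨hs0, hs⟩, hst⟩ := exists_lt_of_csInf_lt hne
    (show psiNorm y < 2 * t by linarith)
  rw [one_div, inv_mul_le_iff₀ (by positivity), mul_one] at hs
  have h2 : ∀ i, y i ^ 2 ≤ 2 * (2 * t) ^ 2 * Real.exp (|y i| / s) := by
    intro i
    have h3 := Real.quadratic_le_exp_of_nonneg (x := |y i| / s) (by positivity)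
    have h4 : 0 ≤ |y i| / s := by positivity
    have h5 : y i ^ 2 = (|y i| / s) ^ 2 * s ^ 2 := by
      rw [← sq_abs (y i)]; field_simp
    have h6 : s ^ 2 ≤ (2 * t) ^ 2 := by gcongr
    rw [h5]
    calc (|y i| / s) ^ 2 * s ^ 2 ≤ (2 * Real.exp (|y i| / s)) * (2 * t) ^ 2 := by
          gcongr; linarith
      _ = _ := by ring
  calc ∑ i, y i ^ 2 ≤ ∑ i, 2 * (2 * t) ^ 2 * Real.exp (|y i| / s) :=
        Finset.sum_le_sum fun i _ => h2 i
    _ = 2 * (2 * t) ^ 2 * ∑ i, Real.exp (|y i| / s) := by rw [Finset.mul_sum]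
    _ ≤ 2 * (2 * t) ^ 2 * (Real.exp 1 * n) := by gcongr
    _ = _ := by ring

theorem nearlyExchangeable_rowWeight {d : ℕ} (hd : 0 < d)
    (hne : (matricesWithRows din dout hmn Y).Nonempty)
    (hdin : ∀ i, din i ≤ d) (hdout : ∀ i, (1 - c₀) * (d : ℝ) ≤ dout i) (hdout' : ∀ i, dout i ≤ d)
    (hdn : (d : ℝ) ≤ (1 / 2 + c₀) * n) (hm : (m : ℝ) ≤ c₀ * n)
    (hp : ∀ l, p din Y l ≤ d ∧ (997 / 1000) * (d : ℝ) ≤ p din Y l) :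
    NearlyExchangeable (rowWeight din dout hmn Y) (dout ⟨m, hmn⟩)
      fun i j => 12 * |p din Y i - p din Y j| / d where
  nonneg S := measureReal_nonneg
  sum_eq_one := sum_rowWeight hne
  card_eq S := card_eq_of_rowWeight_ne_zero
  err_nonneg i j := by positivity
  err_symm i j := by rw [abs_sub_comm]
  err_le_one i j := by
    have hd0 : (0 : ℝ) < d := by exact_mod_cast hd
    have : |p din Y i - p din Y j| ≤ 3 / 1000 * d := by
      rw [abs_le]; constructor <;> linarith [(hp i).1, (hp i).2, (hp j).1, (hp j).2]
    rw [div_le_one hd0]; linarith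
  close T i j hi hj := by
    rw [rowWeight_eq, rowWeight_eq, ← mul_sub, abs_mul,
      abs_of_nonneg (inv_nonneg.2 (Nat.cast_nonneg _)), mul_left_comm]
    exact mul_le_mul_of_nonneg_left
      (abs_card_fiber_sub_le hd hdin hdout hdout' hdn hm hp hi hj)
      (inv_nonneg.2 (Nat.cast_nonneg _))

theorem integral_exp_eta_of_dout_eq_zero (hne : (matricesWithRows din dout hmn Y).Nonempty)
    (h0 : dout ⟨m, hmn⟩ = 0) (x : EuclideanSpace ℝ (Fin n)) (c : ℝ) :
    ∫ v, Real.exp (c * eta (rowLaw din dout hmn Y) x v) ∂(rowLaw din dout hmn Y) = 1 := by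
  rw [integral_exp_eta]
  have hw : ∀ S, rowWeight din dout hmn Y S = 0 ∨ S = ∅ := fun S => by
    by_cases h : rowWeight din dout hmn Y S = 0
    · exact Or.inl h
    · have := card_eq_of_rowWeight_ne_zero h
      rw [h0, Finset.card_eq_zero] at this
      exact Or.inr this
  have hm : mean (rowWeight din dout hmn Y) (linForm x) = 0 := by
    refine Finset.sum_eq_zero fun S _ => ?_
    rcases hw S with h | h <;> simp [h, linForm]
  rw [← sum_rowWeight hne, mean]
  refine Finset.sum_congr rfl fun S _ => ?_
  rcases hw S with h | h
  · simp [h]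
  · simp [h, centred, hm, linForm]

end Law
end RowConcentration

open RowConcentration

theorem mainTheorem7 :
    ∃ C : ℝ, 0 < C ∧
      ∀ L : ℝ, 0 < L →
        ∃ γ : ℝ, 0 < γ ∧ γ ≤ 1 ∧
          ∀ (n d : ℕ) (din dout : Fin n → ℕ) (m : ℕ) (hmn : m < n) (Y : Fin m → Fin n → Bool),
            (∀ i, (1 - RowConcentration.c₀) * (d : ℝ) ≤ (din i : ℝ) ∧ din i ≤ d) →
            (∀ i, (1 - RowConcentration.c₀) * (d : ℝ) ≤ (dout i : ℝ) ∧ dout i ≤ d) →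
            (d : ℝ) ≤ (1 / 2 + RowConcentration.c₀) * (n : ℝ) →
            C * Real.log (n : ℝ) ^ 2 ≤ (d : ℝ) →
            (m : ℝ) ≤ RowConcentration.c₀ * (n : ℝ) →
            (RowConcentration.matricesWithRows din dout hmn Y).Nonempty →
            (∀ l, RowConcentration.p din Y l ≤ (din l : ℝ) ∧
              (1 - 2 * RowConcentration.c₀) * (din l : ℝ) ≤ RowConcentration.p din Y l) →
            RowConcentration.psiNorm (RowConcentration.pVector din Y)
              ≤ L * (n : ℝ) * Real.sqrt (d : ℝ) →
            ∀ x : EuclideanSpace ℝ (Fin n), ‖x‖ = 1 →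
              ∀ lam : ℝ, 0 < lam →
                ∫ v, Real.exp (γ * lam *
                    RowConcentration.eta (RowConcentration.rowLaw din dout hmn Y) x v)
                  ∂(RowConcentration.rowLaw din dout hmn Y)
                ≤ Real.exp ((d : ℝ) / ((n : ℝ) * RowConcentration.supNorm x ^ 2) *
                    RowConcentration.g (lam * RowConcentration.supNorm x)) := by
  refine ⟨1, one_pos, fun L hL => ?_⟩
  -- `60 ^ 2` exceeds `12 ^ 2 * 8 * e`, where `12` comes from the relative error of the weights and
  -- `8 * e` from the second moment of `pVector`.
  set Λ : ℝ := 60 * L with hΛdef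
  have hΛ : 0 < Λ := by positivity
  have hA : 1 ≤ mgfConst Λ := by unfold mgfConst; nlinarith [sq_nonneg Λ]
  have hA0 : 0 < mgfConst Λ := by linarith
  have hγ0 : 0 < 1 / (4 * mgfConst Λ) := by positivity
  have hγ4 : 1 / (4 * mgfConst Λ) ≤ 1 / 4 := by
    rw [div_le_div_iff₀ (by positivity) (by norm_num)]; linarith
  refine ⟨1 / (4 * mgfConst Λ), hγ0, by linarith, ?_⟩
  intro n d din dout m hmn Y hdin hdout hdn _ hm hne hpl hpsi x hx lam hlam
  rcases Nat.eq_zero_or_pos d with rfl | hd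
  · rw [integral_exp_eta_of_dout_eq_zero hne (Nat.le_zero.1 (hdout _).2)]
    simp
  have hd0 : (0 : ℝ) < d := by exact_mod_cast hd
  have hn : 0 < n := (Nat.zero_le m).trans_lt hmn
  have hn0 : (0 : ℝ) < n := by exact_mod_cast hn
  have : Nonempty (Fin n) := ⟨⟨m, hmn⟩⟩
  have hp : ∀ l, p din Y l ≤ d ∧ (997 / 1000) * (d : ℝ) ≤ p din Y l := fun l => by
    have h1 : (din l : ℝ) ≤ d := by exact_mod_cast (hdin l).2
    have h2 := (hdin l).1
    have h3 := (hpl l).2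
    unfold c₀ at h2 h3
    exact ⟨(hpl l).1.trans h1, by linarith⟩
  have H := nearlyExchangeable_rowWeight hd hne (fun i => (hdin i).2) (fun i => (hdout i).1)
    (fun i => (hdout i).2) hdn hm hp
  set k := dout ⟨m, hmn⟩ with hk
  have hkd : (k : ℝ) ≤ d := by exact_mod_cast (hdout _).2
  have hcard : (Fintype.card (Fin n) : ℝ) = n := by simp
  have hx2 : ∑ i, x i ^ 2 = 1 := by
    have := EuclideanSpace.real_norm_sq_eq x
    rw [hx] at this
    linarith
  have hK : ∀ i, |x i| ≤ supNorm x := fun i => norm_le_pi_norm (WithLp.ofLp x) i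
  have hK0 : 0 < supNorm x := by
    have h0 : 0 ≤ supNorm x := norm_nonneg _
    refine h0.lt_of_ne fun h => ?_
    have : ∀ i, x i = 0 := fun i => abs_nonpos_iff.1 ((hK i).trans h.symm.le)
    simp [this] at hx2
  set r := √((d : ℝ) / n) with hr
  have hr0 : 0 < r := Real.sqrt_pos.2 (by positivity)
  have hr2 : r ^ 2 = d / n := Real.sq_sqrt (by positivity)
  have hnr : (n : ℝ) * r ^ 2 = d := by rw [hr2]; field_simp
  have hδ : ∑ i, (∑ j, 12 * |p din Y i - p din Y j| / d) ^ 2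
      ≤ (Λ * Fintype.card (Fin n) / r) ^ 2 := by
    have h1 := sum_sq_le_of_psiNorm_le hn (by positivity) hpsi
    have h2 : ∀ i, (∑ j, 12 * |p din Y i - p din Y j| / d) ^ 2
        = (12 / d) ^ 2 * pVector din Y i ^ 2 := fun i => by
      rw [← mul_pow, pVector, Finset.mul_sum]
      congr 1
      exact Finset.sum_congr rfl fun j _ => by ring
    have he := Real.exp_one_lt_d9
    have h3 : (2 * (L * n * √(d : ℝ))) ^ 2 = 4 * L ^ 2 * n ^ 2 * d := by
      rw [mul_pow, mul_pow, Real.sq_sqrt hd0.le]; ring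
    rw [h3] at h1
    simp only [h2]
    rw [← Finset.mul_sum, hcard, div_pow _ r, hr2, hΛdef]
    calc (12 / (d : ℝ)) ^ 2 * ∑ i, pVector din Y i ^ 2
        ≤ (12 / (d : ℝ)) ^ 2 * (2 * Real.exp 1 * n * (4 * L ^ 2 * n ^ 2 * d)) := by gcongr
      _ = (1152 * Real.exp 1) * (L ^ 2 * n ^ 3 / d) := by field_simp; ring
      _ ≤ 3600 * (L ^ 2 * n ^ 3 / d) := by gcongr; linarith
      _ = _ := by field_simp; ring
  have hfin := H.mean_exp_le (x := x) (by rw [hcard]; unfold c₀ at hdn; linarith) hx2.le hK hK0 hr0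
    hΛ.le (by rw [hcard, hnr]; exact hkd) (by rw [hcard, hnr]; exact_mod_cast hd) hδ hγ0.le hγ4
    (by
      rw [div_pow, one_pow, div_mul_eq_mul_div, one_mul, div_le_one (by positivity)]
      nlinarith) hlam.le
  rw [integral_exp_eta]
  rwa [hr2, div_div] at hfin
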